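/- For $c>0$ let $\varphi_c(x)=\dfrac{3c}{2\cosh^2(\sqrt c\,x/2)}$ be the soliton profile of the Korteweg--de Vries equation, and put $\varphi_c=0$ for $c\le 0$. Fix $c_0>0$. (i) Let $\sigma=(\sigma_{ij})$ be a real $2\times2$ matrix with $\sigma_{11}>0$. There is a constant $K_0>0$, depending only on $c_0$ and $\sigma$, such that for every $\varepsilon>0$ there is $T>0$ (depending only on $c_0,\sigma,\varepsilon$) with the following property. Let $(B_1,B_2)$ be a correlated Brownian motion with covariance $\sigma$, that is, a centred Gaussian process with almost surely continuous paths and $\mathrm{Cov}(B_i(s),B_j(t))=\sigma_{ij}\min(s,t)$, and let $(X^\varepsilon,C^\varepsilon)$ be the solution of $$dX^\varepsilon=c_0\,dt+\varepsilon B_1\,dt+\varepsilon\,dB_2,\qquad dC^\varepsilon=\varepsilon\,dB_1,\qquad X^\varepsilon(0)=0,\quad C^\varepsilon(0)=c_0 .$$ Then for every $t\ge T$ the random variable $\varphi_{C^\varepsilon(t)}(x-X^\varepsilon(t))$ is integrable for each $x\in\mathbb R$, the maximum below is attained, and $$\max_{x\in\mathbb R}\mathbb E\Big(\varphi_{C^\varepsilon(t)}(x-X^\varepsilon(t))\Big)\le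 K_0\,\varepsilon^{-1/2}\,t^{-5/4}.$$ (ii) In particular this applies to the Brownian motions of the soliton modulation equations. Let $k\in L^1(\mathbb R)\cap L^2(\mathbb R)$ be not almost everywhere zero, let $\phi f(x)=\int k(x-y)f(y)\,dy$, and let $W$ be a Wiener process on $L^2(\mathbb R)$ with covariance operator $\phi\phi^*$: the pairings $(f,W(t))$, $f\in L^2(\mathbb R)$, $t\ge0$, are jointly Gaussian and centred, almost surely continuous in $t$ for each $f$, and $\mathbb E[(f,W(s))(g,W(t))]=\min(s,t)\,(\phi^*f,\phi^*g)_{L^2}$. Put $\theta_1=(\varphi_{c_0},\partial_c\varphi_{c_0})^{-1}$ and $$\tilde g_1(x)=-\theta_1\int_{-\infty}^x\partial_c\varphi_{c_0}(y)\,dy+\theta_2\varphi_{c_0}(x),\qquad \theta_2=\theta_1^2\int_{\mathbb R}\Big(\int_{-\infty}^x\partial_c\varphi_{c_0}(y)\,dy\Big)\partial_c\varphi_{c_0}(x)\,dx ,$$ so that $(\tilde g_1,\partial_x\varphi_{c_0})=1$ and $(\tilde g_1,\partial_c\varphi_{c_0})=0$. Let $h_1=\theta_1\varphi_{c_0}^2$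 and $h_2=-\varphi_{c_0}\tilde g_1$. Then $B_1(t)=(h_1,W(t))$ and $B_2(t)=(h_2,W(t))$ form a correlated Brownian motion with covariance $\sigma_{ij}=(\phi^*h_i,\phi^*h_j)_{L^2}$, and $\sigma_{11}>0$. -/

import Mathlib

open MeasureTheory ProbabilityTheory Set
open scoped NNReal ENNReal

namespace KdVSoliton

/-- The soliton profile `φ_c(x) = 3c / (2 cosh²(√c x / 2))` of speed `c > 0`.
There is no soliton of speed `c ≤ 0`, and the profile is then taken to be zero. -/
noncomputable def soliton (c x : ℝ) : ℝ :=
  if 0 < c then 3 * c / (2 * Real.cosh (Real.sqrt c * x / 2) ^ 2) else 0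

/-- A two-dimensional Brownian motion `(B 0, B 1)`, started at `0`, with covariance matrix `σ`:
a centred Gaussian process with `Cov(B_i(s), B_j(t)) = σ_{ij} min(s, t)` and continuous paths. -/
structure IsCorrelatedBrownian {Ω : Type*} [MeasurableSpace Ω]
    (B : Fin 2 → ℝ≥0 → Ω → ℝ) (σ : Matrix (Fin 2) (Fin 2) ℝ) (P : Measure Ω) : Prop where
  gaussian : IsGaussianProcess (fun p : Fin 2 × ℝ≥0 => B p.1 p.2) P
  mean_zero : ∀ i t, ∫ ω, B i t ω ∂P = 0
  cov_eq : ∀ i j s t, covariance (B i s) (B j t) P = σ i j * ((min s t : ℝ≥0) : ℝ)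
  continuous_paths : ∀ i, ∀ᵐ ω ∂P, Continuous fun t => B i t ω

/-- `(X, C)` solves `dX = c₀ dt + ε B₁ dt + ε dB₂`, `dC = ε dB₁`, with `X(0) = 0`, `C(0) = c₀`
(here `B₁ = B 0` and `B₂ = B 1`), written in integrated form. -/
def SolvesModulation {Ω : Type*} [MeasurableSpace Ω] (c₀ ε : ℝ)
    (B : Fin 2 → ℝ≥0 → Ω → ℝ) (X C : ℝ≥0 → Ω → ℝ) (P : Measure Ω) : Prop :=
  ∀ᵐ ω ∂P, ∀ t : ℝ≥0,
    X t ω = c₀ * t + ε * (∫ s in (0 : ℝ)..t, B 0 s.toNNReal ω) + ε * B 1 t ω ∧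
    C t ω = c₀ + ε * B 0 t ω

/-- The adjoint `φ*` of the convolution operator `φ f (x) = ∫ k(x - y) f(y) dy`. -/
noncomputable def convAdjoint (k f : ℝ → ℝ) (y : ℝ) : ℝ :=
  ∫ x, k (x - y) * f x

/-- `W f t = (f, W(t))` is a Wiener process on `L²(ℝ)` with covariance operator `φ φ*`, where `φ`
is the convolution with `k`: the pairings with `f ∈ L²(ℝ)` are jointly Gaussian, centred, with
`E[(f, W(s)) (g, W(t))] = min(s, t) (φ* f, φ* g)`, and continuous in time. -/
structure IsWienerNoise {Ω : Type*} [MeasurableSpace Ω] (k : ℝ → ℝ)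
    (W : (ℝ → ℝ) → ℝ≥0 → Ω → ℝ) (P : Measure Ω) : Prop where
  gaussian : IsGaussianProcess
    (fun p : {f : ℝ → ℝ // MemLp f 2 volume} × ℝ≥0 => W p.1.1 p.2) P
  mean_zero : ∀ f, MemLp f 2 volume → ∀ t, ∫ ω, W f t ω ∂P = 0
  cov_eq : ∀ f g, MemLp f 2 volume → MemLp g 2 volume → ∀ s t,
    covariance (W f s) (W g t) P
      = ((min s t : ℝ≥0) : ℝ) * ∫ y, convAdjoint k f y * convAdjoint k g y
  continuous_paths : ∀ f, MemLp f 2 volume → ∀ᵐ ω ∂P, Continuous fun t => W f t ω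

/-- `∂_c φ_c` at `c = c₀`. -/
noncomputable def dcSoliton (c₀ x : ℝ) : ℝ := deriv (fun c => soliton c x) c₀

/-- `x ↦ ∫_{-∞}^x ∂_c φ_{c₀}(y) dy`. -/
noncomputable def dcPrimitive (c₀ x : ℝ) : ℝ := ∫ y in Iic x, dcSoliton c₀ y

/-- `θ₁ = (φ_{c₀}, ∂_c φ_{c₀})⁻¹`, so that `(θ₁ φ_{c₀}, ∂_c φ_{c₀}) = 1`. -/
noncomputable def theta₁ (c₀ : ℝ) : ℝ := (∫ x, soliton c₀ x * dcSoliton c₀ x)⁻¹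

/-- The constant `θ₂` for which `(g₁, ∂_c φ_{c₀}) = 0`, with `g₁` as below. -/
noncomputable def theta₂ (c₀ : ℝ) : ℝ :=
  theta₁ c₀ ^ 2 * ∫ x, dcPrimitive c₀ x * dcSoliton c₀ x

/-- The dual generalized null vector `g₁ = -θ₁ ∫_{-∞}^x ∂_c φ_{c₀} + θ₂ φ_{c₀}` of the linearized
operator, normalized by `(g₁, ∂_x φ_{c₀}) = 1` and `(g₁, ∂_c φ_{c₀}) = 0`. -/
noncomputable def dualVector (c₀ x : ℝ) : ℝ :=
  -theta₁ c₀ * dcPrimitive c₀ x + theta₂ c₀ * soliton c₀ x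

/-- The functions `h₀ = θ₁ φ_{c₀}²` and `h₁ = -φ_{c₀} g₁` against which the noise is tested. -/
noncomputable def modulationTest (c₀ : ℝ) : Fin 2 → ℝ → ℝ :=
  ![fun x => theta₁ c₀ * soliton c₀ x ^ 2, fun x => -(soliton c₀ x * dualVector c₀ x)]

/-- The processes driving the modulation equations: `B₁ = (φ_{c₀}, ∂_c φ_{c₀})⁻¹ (φ_{c₀}², W)` and
`B₂ = -(W, φ_{c₀} g₁)`. -/
noncomputable def modulationNoise {Ω : Type*} (c₀ : ℝ) (W : (ℝ → ℝ) → ℝ≥0 → Ω → ℝ) :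
    Fin 2 → ℝ≥0 → Ω → ℝ :=
  fun i => W (modulationTest c₀ i)

/-- The covariance matrix `σ_{ij} = (φ* h_i, φ* h_j)`. -/
noncomputable def modulationCov (k : ℝ → ℝ) (c₀ : ℝ) : Matrix (Fin 2) (Fin 2) ℝ :=
  Matrix.of fun i j =>
    ∫ y, convAdjoint k (modulationTest c₀ i) y * convAdjoint k (modulationTest c₀ j) y

end KdVSoliton

/-! Part (i) is a Gaussian conditioning argument. Given B₁(t), the amplitude C(t) is fixed, while
∫₀ᵗ B₁ still fluctuates like the area under a Brownian bridge, with variance σ₁₁t³/12. For large t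
the conditional law of X(t) therefore has a density at most of order ε⁻¹t^(-3/2). The conditional
expectation of the profile is at most this bound times ∫ φ_C, which is of order √C⁺. Since C - c₀
has size ε√t, the mean of √C⁺ is at most of order ε^(1/2)t^(1/4) once ε²t ≥ 1, and the product is
the stated rate.

To stay with finite-dimensional Gaussian vectors, ∫₀ᵗ B₁ is replaced by Riemann sums.
`exists_indep_residual` removes the regression on B₁(t) and bounds the remaining variance below
uniformly in the mesh, `lintegral_le_of_indepFun_gaussian` turns this into the density bound, and
Fatou's lemma removes the mesh.

In part (ii) only σ₁₁ > 0 is not formal. It is the squared norm of φ*h₁, the convolution of h₁ with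
the reflected kernel. The scaling identity for (φ, ∂_cφ) gives θ₁ > 0, so h₁ is positive and decays
exponentially. Its Fourier transform is thus analytic with isolated zeros. If φ*h₁ = 0, the
transform of k vanishes off these zeros, hence everywhere by continuity, and k = 0. -/

namespace KdVSoliton

open Filter Topology

/-! ### Pointwise bounds and mass of the soliton profile. -/

section Profile

lemma soliton_of_pos {c : ℝ} (hc : 0 < c) (x : ℝ) :
    soliton c x = 3 * c / (2 * Real.cosh (Real.sqrt c * x / 2) ^ 2) := if_pos hc

lemma soliton_of_nonpos {c : ℝ} (hc : c ≤ 0) (x : ℝ) : soliton c x = 0 := if_neg hc.not_gt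

lemma soliton_nonneg (c x : ℝ) : 0 ≤ soliton c x := by
  rcases lt_or_ge 0 c with hc | hc
  · rw [soliton_of_pos hc]; positivity
  · rw [soliton_of_nonpos hc]

/-- From cosh² = 1 + sinh² and |u| ≤ |sinh u|. The resulting Lorentzian majorant has an explicit
integral and tends to zero at infinity. -/
lemma one_add_sq_le_cosh_sq (u : ℝ) : 1 + u ^ 2 ≤ Real.cosh u ^ 2 := by
  rw [Real.cosh_sq]
  have h : |u| ≤ |Real.sinh u| := by
    rcases le_total 0 u with hu | hu
    · rw [abs_of_nonneg hu, abs_of_nonneg (Real.sinh_nonneg_iff.2 hu)]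
      exact Real.self_le_sinh_iff.2 hu
    · rw [abs_of_nonpos hu, abs_of_nonpos (Real.sinh_nonpos_iff.2 hu)]
      linarith [Real.sinh_le_self_iff.2 hu]
  linarith [sq_le_sq.2 h]

lemma soliton_le_lorentzian (c x : ℝ) :
    soliton c x ≤ 3 / 2 * max c 0 * (1 + (Real.sqrt c * x / 2) ^ 2)⁻¹ := by
  rcases lt_or_ge 0 c with hc | hc
  · rw [soliton_of_pos hc, max_eq_left hc.le]
    have h := one_add_sq_le_cosh_sq (Real.sqrt c * x / 2)
    have h0 : 0 < 1 + (Real.sqrt c * x / 2) ^ 2 := by positivity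
    calc 3 * c / (2 * Real.cosh (Real.sqrt c * x / 2) ^ 2)
        ≤ 3 * c / (2 * (1 + (Real.sqrt c * x / 2) ^ 2)) := by gcongr
      _ = _ := by field_simp
  · rw [soliton_of_nonpos hc]; positivity

lemma soliton_le (c x : ℝ) : soliton c x ≤ 3 / 2 * max c 0 := by
  refine (soliton_le_lorentzian c x).trans ?_
  refine mul_le_of_le_one_right (by positivity) (inv_le_one_of_one_le₀ ?_)
  nlinarith [sq_nonneg (Real.sqrt c * x / 2)]

lemma continuous_soliton (c : ℝ) : Continuous (soliton c) := by
  rcases lt_or_ge 0 c with hc | hc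
  · have : soliton c = fun x => 3 * c / (2 * Real.cosh (Real.sqrt c * x / 2) ^ 2) :=
      funext (soliton_of_pos hc)
    rw [this]
    refine Continuous.div (by fun_prop) (by fun_prop) fun x => ?_
    have := Real.cosh_pos (Real.sqrt c * x / 2)
    positivity
  · have : soliton c = fun _ => 0 := funext (soliton_of_nonpos hc)
    rw [this]; fun_prop

lemma measurable_soliton : Measurable fun p : ℝ × ℝ => soliton p.1 p.2 := by
  unfold soliton
  refine Measurable.ite (measurableSet_lt measurable_const measurable_fst) ?_ measurable_const
  have : Measurable Real.cosh := Real.continuous_cosh.measurable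
  fun_prop

lemma tendsto_soliton_cocompact (c : ℝ) : Tendsto (soliton c) (cocompact ℝ) (𝓝 0) := by
  rcases lt_or_ge 0 c with hc | hc
  · have h1 : Tendsto (fun x : ℝ => Real.sqrt c / 2 * ‖x‖) (cocompact ℝ) atTop :=
      tendsto_norm_cocompact_atTop.const_mul_atTop (by positivity)
    have h2 : Tendsto (fun x : ℝ => 1 + (Real.sqrt c * x / 2) ^ 2) (cocompact ℝ) atTop := by
      refine tendsto_atTop_add_const_left _ _ ?_
      refine ((tendsto_pow_atTop two_ne_zero).comp h1).congr fun x => ?_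
      simp only [Function.comp, mul_pow, Real.norm_eq_abs, sq_abs]
      ring
    have h3 := h2.inv_tendsto_atTop.const_mul (3 / 2 * max c 0)
    rw [mul_zero] at h3
    exact squeeze_zero (soliton_nonneg c) (soliton_le_lorentzian c) h3
  · have : soliton c = fun _ => 0 := funext (soliton_of_nonpos hc)
    rw [this]; exact tendsto_const_nhds

/-- Integrating the Lorentzian majorant loses a constant (the exact mass is 6√c) but keeps the
scaling √c, which is all that the rate needs. -/
lemma lintegral_soliton_le (c : ℝ) :
    ∫⁻ x, ENNReal.ofReal (soliton c x)
      ≤ ENNReal.ofReal (3 * Real.pi * Real.sqrt (max c 0)) := by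
  rcases lt_or_ge 0 c with hc | hc
  · have hs : 0 < Real.sqrt c := Real.sqrt_pos.2 hc
    have hi : Integrable (fun x : ℝ => 3 / 2 * c * (1 + (Real.sqrt c / 2 * x) ^ 2)⁻¹) :=
      (integrable_inv_one_add_sq.comp_mul_left' (by positivity)).const_mul _
    calc ∫⁻ x, ENNReal.ofReal (soliton c x)
        ≤ ∫⁻ x, ENNReal.ofReal (3 / 2 * c * (1 + (Real.sqrt c / 2 * x) ^ 2)⁻¹) := by
          refine lintegral_mono fun x => ENNReal.ofReal_le_ofReal ?_
          convert soliton_le_lorentzian c x using 4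
          · rw [max_eq_left hc.le]
          · ring
      _ = ENNReal.ofReal (∫ x, 3 / 2 * c * (1 + (Real.sqrt c / 2 * x) ^ 2)⁻¹) :=
          (ofReal_integral_eq_lintegral_ofReal hi
            (Eventually.of_forall fun x => by positivity)).symm
      _ = _ := by
          rw [integral_const_mul, Measure.integral_comp_mul_left (fun y : ℝ => (1 + y ^ 2)⁻¹),
            integral_univ_inv_one_add_sq, max_eq_left hc.le, abs_of_pos (by positivity),
            smul_eq_mul]
          congr 1
          have := Real.mul_self_sqrt hc.le
          field_simp
          linear_combination -this
  · simp [soliton_of_nonpos hc]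

end Profile

/-! ### Independence and bounded Gaussian densities. -/

section GaussianConditioning

variable {Ω : Type*} [MeasurableSpace Ω] {P : Measure Ω}

/-- The Gaussian density never exceeds its peak value (2πv)^(-1/2). -/
lemma gaussianReal_le_volume (m : ℝ) {v : ℝ≥0} (hv : v ≠ 0) (f : ℝ → ℝ≥0∞) :
    ∫⁻ z, f z ∂(gaussianReal m v) ≤ ENNReal.ofReal (Real.sqrt (2 * Real.pi * v))⁻¹ * ∫⁻ z, f z := by
  rw [gaussianReal_of_var_ne_zero m hv]
  calc ∫⁻ z, f z ∂(volume.withDensity (gaussianPDF m v))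
      ≤ ∫⁻ z, f z ∂(ENNReal.ofReal (Real.sqrt (2 * Real.pi * v))⁻¹ • (volume : Measure ℝ)) := by
        refine lintegral_mono' ?_ le_rfl
        rw [← withDensity_const]
        refine withDensity_mono (Eventually.of_forall fun z => ENNReal.ofReal_le_ofReal ?_)
        rw [gaussianPDFReal]
        refine mul_le_of_le_one_right (by positivity) (Real.exp_le_one_iff.2 ?_)
        exact div_nonpos_of_nonpos_of_nonneg (neg_nonpos.2 (sq_nonneg _)) (by positivity)
    _ = _ := by rw [lintegral_smul_measure, smul_eq_mul]

/-- If `Z` is a nondegenerate Gaussian independent of `U`, the conditional law of `Z` given `U` has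
a density bounded by that of `Z`. -/
lemma lintegral_le_of_indepFun_gaussian [IsProbabilityMeasure P] {U Z : Ω → ℝ}
    (hU : AEMeasurable U P) (hZ : AEMeasurable Z P) (hUZ : IndepFun U Z P) {m : ℝ} {v : ℝ≥0}
    (hlaw : P.map Z = gaussianReal m v) (hv : v ≠ 0) {F : ℝ × ℝ → ℝ≥0∞} (hF : Measurable F) :
    ∫⁻ ω, F (U ω, Z ω) ∂P
      ≤ ENNReal.ofReal (Real.sqrt (2 * Real.pi * v))⁻¹ * ∫⁻ ω, (∫⁻ z, F (U ω, z)) ∂P := by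
  have h1 : ∫⁻ ω, F (U ω, Z ω) ∂P = ∫⁻ p, F p ∂(P.map fun ω => (U ω, Z ω)) :=
    (lintegral_map' hF.aemeasurable (hU.prodMk hZ)).symm
  have : IsProbabilityMeasure (P.map Z) := Measure.isProbabilityMeasure_map hZ
  rw [h1, (indepFun_iff_map_prod_eq_prod_map_map hU hZ).1 hUZ, lintegral_prod _ hF.aemeasurable,
    lintegral_map' hF.lintegral_prod_right'.aemeasurable hU, hlaw,
    ← lintegral_const_mul' _ _ ENNReal.ofReal_ne_top]
  exact lintegral_mono fun ω => gaussianReal_le_volume m hv _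

lemma _root_.ProbabilityTheory.IsGaussianProcess.hasGaussianLaw_eval_prodMk_sum {T : Type*}
    {X : T → Ω → ℝ} (hX : IsGaussianProcess X P) (j : T) (s : Finset T) (a : T → ℝ) :
    HasGaussianLaw (fun ω => (X j ω, ∑ i ∈ s, a i * X i ω)) P := by
  classical
  let L : (↥(insert j s) → ℝ) →L[ℝ] ℝ × ℝ :=
    (ContinuousLinearMap.proj (R := ℝ) (φ := fun _ => ℝ)
      (⟨j, Finset.mem_insert_self j s⟩ : (insert j s : Finset T))).prod
      (∑ i : s, a i • ContinuousLinearMap.proj (R := ℝ) (φ := fun _ => ℝ)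
        (⟨i, Finset.mem_insert_of_mem i.2⟩ : (insert j s : Finset T)))
  have h := (hX.hasGaussianLaw (insert j s)).map L
  refine h.congr (Eventually.of_forall fun ω => Prod.ext ?_ ?_)
  · simp [L]
  · simp only [L, Function.comp, ContinuousLinearMap.prod_apply, sum_apply, smul_apply,
      ContinuousLinearMap.proj_apply, Finset.restrict, smul_eq_mul]
    exact Finset.sum_coe_sort s fun i => a i * X i ω

end GaussianConditioning

/-! ### Riemann sums and the sums in their covariances. -/

section RiemannSums

lemma sum_range_succ_id (n : ℕ) : ∑ i ∈ Finset.range n, ((i : ℝ) + 1) = n * (n + 1) / 2 := by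
  induction n with
  | zero => simp
  | succ n ih => rw [Finset.sum_range_succ, ih]; push_cast; ring

lemma sum_range_succ_min (n : ℕ) :
    ∑ i ∈ Finset.range n, ∑ j ∈ Finset.range n, min ((i : ℝ) + 1) (j + 1)
      = n * (n + 1) * (2 * n + 1) / 6 := by
  induction n with
  | zero => simp
  | succ n ih =>
    have h1 : ∀ i ∈ Finset.range n, min ((i : ℝ) + 1) (n + 1) = i + 1 := fun i hi => by
      have : (i : ℝ) ≤ n := by exact_mod_cast (Finset.mem_range.1 hi).le
      exact min_eq_left (by linarith)
    have h2 : ∀ i ∈ Finset.range n, min ((n : ℝ) + 1) (i + 1) = i + 1 := fun i hi => by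
      rw [min_comm, h1 i hi]
    have h3 := sum_range_succ_id n
    simp only [Finset.sum_range_succ, Finset.sum_add_distrib, ih, Finset.sum_congr rfl h1,
      Finset.sum_congr rfl h2, h3, min_self]
    push_cast
    ring

/-- Right-endpoint Riemann sums of a continuous function converge to its integral. -/
lemma tendsto_riemann_sum {f : ℝ → ℝ} (hf : Continuous f) {t : ℝ} (ht : 0 ≤ t) :
    Tendsto (fun n : ℕ => ∑ i ∈ Finset.range n, t / n * f (t * (i + 1) / n)) atTop
      (𝓝 (∫ s in (0 : ℝ)..t, f s)) := by
  rw [Metric.tendsto_atTop]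
  intro δ hδ
  have huc : UniformContinuousOn f (Icc 0 t) :=
    isCompact_Icc.uniformContinuousOn_of_continuous hf.continuousOn
  -- The tolerance δ / (t + 1) makes the total error δ t / (t + 1), which is below δ even when t =
  -- 0.
  obtain ⟨η, hη, hfη⟩ := Metric.uniformContinuousOn_iff.1 huc (δ / (t + 1)) (by positivity)
  obtain ⟨N, hN⟩ := exists_nat_gt (t / η)
  refine ⟨N + 1, fun n hn => ?_⟩
  have hn0 : (0 : ℝ) < n := by exact_mod_cast (Nat.succ_pos N).trans_le hn
  have hmesh : t / n < η := by
    rw [div_lt_iff₀ hn0]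
    rw [div_lt_iff₀ hη] at hN
    have : (N : ℝ) ≤ n := by exact_mod_cast (Nat.le_succ N).trans hn
    nlinarith
  have hsplit : ∫ s in (0 : ℝ)..t, f s
      = ∑ i ∈ Finset.range n, ∫ s in (t * i / n)..(t * (i + 1) / n), f s := by
    have := intervalIntegral.sum_integral_adjacent_intervals (μ := volume) (f := f)
      (a := fun i : ℕ => t * i / n) (n := n) fun i _ => hf.intervalIntegrable _ _
    simp only [Nat.cast_add, Nat.cast_one, Nat.cast_zero, mul_zero, zero_div] at this
    rw [this, mul_div_cancel_right₀ _ hn0.ne']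
  have hterm : ∀ i ∈ Finset.range n,
      |t / n * f (t * (i + 1) / n) - ∫ s in (t * i / n)..(t * (i + 1) / n), f s|
        ≤ δ / (t + 1) * (t / n) := by
    intro i hi
    have hlen : t * (i + 1) / n - t * i / n = t / n := by ring
    have hle : t * i / n ≤ t * (i + 1) / n := by
      have : 0 ≤ t / n := by positivity
      linarith
    have hi1 : (i : ℝ) + 1 ≤ n := by exact_mod_cast Finset.mem_range.1 hi
    have htop : t * (i + 1) / n ≤ t := by
      rw [div_le_iff₀ hn0]; exact mul_le_mul_of_nonneg_left hi1 ht
    have hbot : 0 ≤ t * i / n := by positivity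
    have hconst : t / n * f (t * (i + 1) / n)
        = ∫ _ in (t * i / n)..(t * (i + 1) / n), f (t * (i + 1) / n) := by
      rw [intervalIntegral.integral_const, hlen, smul_eq_mul]
    rw [hconst, ← intervalIntegral.integral_sub (by simp) (hf.intervalIntegrable _ _)]
    have := intervalIntegral.norm_integral_le_of_norm_le_const (a := t * i / n)
      (b := t * (i + 1) / n) (C := δ / (t + 1))
      (f := fun s => f (t * (i + 1) / n) - f s) fun s hs => by
        rw [uIoc_of_le hle] at hs
        rw [← dist_eq_norm]
        refine (hfη _ ⟨hbot.trans hle, htop⟩ s ⟨hbot.trans hs.1.le, hs.2.trans htop⟩ ?_).le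
        rw [Real.dist_eq, abs_of_nonneg (sub_nonneg.2 hs.2)]
        linarith [hs.1]
    rwa [hlen, abs_of_nonneg (by positivity : 0 ≤ t / (n : ℝ)), Real.norm_eq_abs] at this
  rw [Real.dist_eq, hsplit, ← Finset.sum_sub_distrib]
  calc |∑ i ∈ Finset.range n,
          (t / n * f (t * (i + 1) / n) - ∫ s in (t * i / n)..(t * (i + 1) / n), f s)|
      ≤ ∑ i ∈ Finset.range n, δ / (t + 1) * (t / n) :=
        (Finset.abs_sum_le_sum_abs _ _).trans (Finset.sum_le_sum hterm)
    _ = δ * (t / (t + 1)) := by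
        rw [Finset.sum_const, Finset.card_range, nsmul_eq_mul]; field_simp
    _ < δ := by
        have : t / (t + 1) < 1 := by rw [div_lt_one (by positivity)]; linarith
        nlinarith

end RiemannSums

/-! ### Covariance structure of the discretized drift. -/

section Brownian

variable {Ω : Type*} [MeasurableSpace Ω] {P : Measure Ω}
  {B : Fin 2 → ℝ≥0 → Ω → ℝ} {σ : Matrix (Fin 2) (Fin 2) ℝ}

/-- The grid points `t (i + 1) / n`. -/
noncomputable def gridPoint (t : ℝ≥0) (n i : ℕ) : ℝ≥0 := t * (i + 1) / n

/-- The discretization of `∫₀ᵗ B₁ ds + B₂(t)` by a Riemann sum. -/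
noncomputable def discreteDrift (B : Fin 2 → ℝ≥0 → Ω → ℝ) (t : ℝ≥0) (n : ℕ) (ω : Ω) : ℝ :=
  (∑ i ∈ Finset.range n, (t : ℝ) / n * B 0 (gridPoint t n i) ω) + B 1 t ω

lemma IsCorrelatedBrownian.hasGaussianLaw (hB : IsCorrelatedBrownian B σ P) (i : Fin 2) (t : ℝ≥0) :
    HasGaussianLaw (B i t) P := hB.gaussian.hasGaussianLaw_eval (i, t)

lemma IsCorrelatedBrownian.memLp (hB : IsCorrelatedBrownian B σ P) (i : Fin 2) (t : ℝ≥0) :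
    MemLp (B i t) 2 P := (hB.hasGaussianLaw i t).memLp_two

lemma IsCorrelatedBrownian.hasGaussianLaw_drift (hB : IsCorrelatedBrownian B σ P) (t : ℝ≥0)
    (n : ℕ) : HasGaussianLaw (fun ω => (B 0 t ω, discreteDrift B t n ω)) P := by
  -- Indexing by ℕ allows repetitions: the last grid point is t itself, so `B 0 t` occurs both as
  -- the first component (index 0, weight 0 in the sum) and inside the Riemann sum.
  let f : ℕ → Fin 2 × ℝ≥0 := fun i => if i = 0 then (0, t) else
    if i = 1 then (1, t) else (0, gridPoint t n (i - 2))
  have h := (hB.gaussian.comp_right f).hasGaussianLaw_eval_prodMk_sum 0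
    (Finset.range (n + 2)) fun i => if i = 0 then 0 else if i = 1 then 1 else (t : ℝ) / n
  convert! h using 3 with ω
  rw [Finset.sum_range_succ', Finset.sum_range_succ']
  simp [f, discreteDrift]

lemma IsCorrelatedBrownian.memLp_drift (hB : IsCorrelatedBrownian B σ P) (t : ℝ≥0) (n : ℕ) :
    MemLp (discreteDrift B t n) 2 P := (hB.hasGaussianLaw_drift t n).snd.memLp_two

lemma IsCorrelatedBrownian.memLp_riemann (hB : IsCorrelatedBrownian B σ P) (t : ℝ≥0) (n : ℕ) :
    MemLp (fun ω => ∑ i ∈ Finset.range n, (t : ℝ) / n * B 0 (gridPoint t n i) ω) 2 P :=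
  memLp_finsetSum _ fun _ _ => (hB.memLp 0 _).const_mul _

lemma gridPoint_le (t : ℝ≥0) {n i : ℕ} (hi : i < n) : gridPoint t n i ≤ t := by
  have hn : 0 < n := by omega
  unfold gridPoint
  rw [div_le_iff₀ (by exact_mod_cast hn)]
  gcongr
  exact_mod_cast hi

variable [IsProbabilityMeasure P]

lemma IsCorrelatedBrownian.cov_riemann_left (hB : IsCorrelatedBrownian B σ P) (t : ℝ≥0) {n : ℕ}
    (hn : 0 < n) (i : Fin 2) :
    covariance (fun ω => ∑ i ∈ Finset.range n, (t : ℝ) / n * B 0 (gridPoint t n i) ω) (B i t) P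
      = σ 0 i * t ^ 2 * (n + 1) / (2 * n) := by
  rw [covariance_fun_sum_left' (fun _ _ => (hB.memLp 0 _).const_mul _) (hB.memLp i t)]
  have : ∀ j ∈ Finset.range n, covariance (fun ω => (t : ℝ) / n * B 0 (gridPoint t n j) ω) (B i t) P
      = σ 0 i * t ^ 2 / n ^ 2 * (j + 1) := fun j hj => by
    rw [covariance_const_mul_left, hB.cov_eq, min_eq_left (gridPoint_le t (Finset.mem_range.1 hj))]
    simp only [gridPoint]
    push_cast
    field_simp
  have hn' : (n : ℝ) ≠ 0 := by exact_mod_cast hn.ne'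
  rw [Finset.sum_congr rfl this, ← Finset.mul_sum, sum_range_succ_id]
  field_simp

lemma IsCorrelatedBrownian.var_riemann (hB : IsCorrelatedBrownian B σ P) (t : ℝ≥0) {n : ℕ}
    (hn : 0 < n) :
    covariance (fun ω => ∑ i ∈ Finset.range n, (t : ℝ) / n * B 0 (gridPoint t n i) ω)
      (fun ω => ∑ i ∈ Finset.range n, (t : ℝ) / n * B 0 (gridPoint t n i) ω) P
      = σ 0 0 * t ^ 3 * (n + 1) * (2 * n + 1) / (6 * n ^ 2) := by
  have hn' : (n : ℝ) ≠ 0 := by exact_mod_cast hn.ne'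
  rw [covariance_fun_sum_fun_sum' (fun i _ => (hB.memLp 0 _).const_mul _)
    (fun i _ => (hB.memLp 0 _).const_mul _)]
  have : ∀ i j : ℕ, covariance (fun ω => (t : ℝ) / n * B 0 (gridPoint t n i) ω)
      (fun ω => (t : ℝ) / n * B 0 (gridPoint t n j) ω) P
      = σ 0 0 * t ^ 3 / n ^ 3 * min ((i : ℝ) + 1) (j + 1) := fun i j => by
    rw [covariance_const_mul_left, covariance_const_mul_right, hB.cov_eq]
    have : ((min (gridPoint t n i) (gridPoint t n j) : ℝ≥0) : ℝ)
        = t / n * min ((i : ℝ) + 1) (j + 1) := by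
      rw [mul_min_of_nonneg _ _ (by positivity)]
      simp only [gridPoint, NNReal.coe_min]
      push_cast
      congr 1 <;> ring
    rw [this]
    field_simp
  simp only [this, ← Finset.mul_sum, sum_range_succ_min]
  field_simp

lemma IsCorrelatedBrownian.cov_drift (hB : IsCorrelatedBrownian B σ P) (t : ℝ≥0) {n : ℕ}
    (hn : 0 < n) :
    covariance (discreteDrift B t n) (B 0 t) P
      = σ 0 0 * t ^ 2 * (n + 1) / (2 * n) + σ 0 1 * t := by
  have h : covariance (B 1 t) (B 0 t) P = σ 0 1 * t := by
    rw [covariance_comm, hB.cov_eq, min_self]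
  have := covariance_add_left (hB.memLp_riemann t n) (hB.memLp 1 t) (hB.memLp 0 t)
  rw [hB.cov_riemann_left t hn, h] at this
  exact this

lemma IsCorrelatedBrownian.var_drift (hB : IsCorrelatedBrownian B σ P) (t : ℝ≥0) {n : ℕ}
    (hn : 0 < n) :
    covariance (discreteDrift B t n) (discreteDrift B t n) P
      = σ 0 0 * t ^ 3 * (n + 1) * (2 * n + 1) / (6 * n ^ 2) + σ 0 1 * t ^ 2 * (n + 1) / n
        + σ 1 1 * t := by
  have h1 := covariance_add_left (hB.memLp_riemann t n) (hB.memLp 1 t) (hB.memLp_drift t n)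
  have h2 := covariance_add_right (hB.memLp_riemann t n) (hB.memLp_riemann t n) (hB.memLp 1 t)
  have h3 := covariance_add_right (hB.memLp 1 t) (hB.memLp_riemann t n) (hB.memLp 1 t)
  rw [hB.var_riemann t hn, hB.cov_riemann_left t hn] at h2
  rw [covariance_comm (B 1 t)
    (fun ω => ∑ i ∈ Finset.range n, (t : ℝ) / n * B 0 (gridPoint t n i) ω),
    hB.cov_riemann_left t hn, hB.cov_eq, min_self] at h3
  have hn' : (n : ℝ) ≠ 0 := by exact_mod_cast hn.ne'
  refine h1.trans ((congrArg₂ (· + ·) h2 h3).trans ?_)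
  field_simp
  ring

/-- The part of the discretized drift that is uncorrelated with `B₁(t)`. -/
noncomputable def driftResidual (B : Fin 2 → ℝ≥0 → Ω → ℝ) (t : ℝ≥0) (n : ℕ) (β : ℝ) (ω : Ω) : ℝ :=
  discreteDrift B t n ω - β * B 0 t ω

/-- The discretized drift is a multiple of `B₁(t)` plus an independent Gaussian whose variance is
bounded below, uniformly in the mesh. -/
lemma IsCorrelatedBrownian.exists_indep_residual (hB : IsCorrelatedBrownian B σ P) (hσ : 0 < σ 0 0)
    {t : ℝ≥0} (ht : 0 < t) (ht' : -(σ 1 1 - σ 0 1 ^ 2 / σ 0 0) ≤ σ 0 0 * t ^ 2 / 32)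
    {n : ℕ} (hn : 2 ≤ n) :
    ∃ β : ℝ, IndepFun (B 0 t) (driftResidual B t n β) P ∧
      HasGaussianLaw (driftResidual B t n β) P ∧
      σ 0 0 * t ^ 3 / 32 ≤ variance (driftResidual B t n β) P := by
  have hn0 : 0 < n := by omega
  have hn' : (n : ℝ) ≠ 0 := by exact_mod_cast hn0.ne'
  have ht0 : (0 : ℝ) < t := by exact_mod_cast ht
  set r : ℝ := σ 0 0 * t ^ 2 * (n + 1) / (2 * n) + σ 0 1 * t with hr
  -- The regression coefficient Cov(drift, B₁(t)) / Var B₁(t), which makes the residual uncorrelated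
  -- with B₁(t), hence independent of it by joint Gaussianity.
  set β : ℝ := r / (σ 0 0 * t) with hβ
  have hβr : β * (σ 0 0 * t) = r := by rw [hβ]; field_simp
  have hmul : MemLp (fun ω => β * B 0 t ω) 2 P := (hB.memLp 0 t).const_mul β
  have hpair : HasGaussianLaw (fun ω => (B 0 t ω, driftResidual B t n β ω)) P :=
    (hB.hasGaussianLaw_drift t n).map_fun ((ContinuousLinearMap.fst ℝ ℝ ℝ).prod
      (ContinuousLinearMap.snd ℝ ℝ ℝ - β • ContinuousLinearMap.fst ℝ ℝ ℝ))
  have h00 : covariance (B 0 t) (B 0 t) P = σ 0 0 * t := by rw [hB.cov_eq, min_self]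
  have hcov : covariance (driftResidual B t n β) (B 0 t) P = 0 := by
    refine (covariance_fun_sub_left (hB.memLp_drift t n) hmul (hB.memLp 0 t)).trans ?_
    rw [covariance_const_mul_left, hB.cov_drift t hn0, h00, hβr, sub_self]
  have hres : MemLp (driftResidual B t n β) 2 P := hpair.snd.memLp_two
  refine ⟨β, hpair.indepFun_of_covariance_eq_zero (by rw [covariance_comm, hcov]), hpair.snd, ?_⟩
  have hvar : variance (driftResidual B t n β) P
      = covariance (discreteDrift B t n) (discreteDrift B t n) P - β * r := by
    rw [← covariance_self hpair.snd.aemeasurable]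
    refine (covariance_fun_sub_right hres (hB.memLp_drift t n) hmul).trans ?_
    rw [covariance_const_mul_right, hcov, mul_zero, sub_zero]
    refine (covariance_fun_sub_left (hB.memLp_drift t n) hmul (hB.memLp_drift t n)).trans ?_
    rw [covariance_const_mul_left, covariance_comm (B 0 t), hB.cov_drift t hn0]
  rw [hvar, hB.var_drift t hn0]
  have hn2 : (2 : ℝ) ≤ n := by exact_mod_cast hn
  -- The cross terms in σ₀₁t² cancel. What remains is the discrete bridge variance σ₀₀t³(1 -
  -- 1/n²)/12 plus the Schur complement of σ times t.
  have key : σ 0 0 * t ^ 3 * (n + 1) * (2 * n + 1) / (6 * n ^ 2) + σ 0 1 * t ^ 2 * (n + 1) / n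
        + σ 1 1 * t - β * r
      = σ 0 0 * t ^ 3 * ((n ^ 2 - 1) / (12 * n ^ 2)) + (σ 1 1 - σ 0 1 ^ 2 / σ 0 0) * t := by
    rw [hβ, hr]
    field_simp
    ring
  -- Equality holds at n = 2. Half of 1/16 is spent on absorbing a possibly negative Schur
  -- complement through `ht'`; the other half is the 1/32 of the conclusion.
  have h16 : (1 : ℝ) / 16 ≤ (n ^ 2 - 1) / (12 * n ^ 2) := by
    rw [div_le_div_iff₀ (by norm_num) (by positivity)]
    nlinarith
  rw [key]
  have h1 : σ 0 0 * t ^ 3 * (1 / 16) ≤ σ 0 0 * t ^ 3 * ((n ^ 2 - 1) / (12 * n ^ 2)) := by gcongr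
  have h2 := mul_le_mul_of_nonneg_right ht' ht0.le
  nlinarith

end Brownian

/-! ### Integrability and existence of the maximum. -/

section Maximum

variable {Ω : Type*} [MeasurableSpace Ω] {P : Measure Ω} {X C : Ω → ℝ}

lemma aestronglyMeasurable_soliton (hC : AEMeasurable C P) (hX : AEMeasurable X P) (x : ℝ) :
    AEStronglyMeasurable (fun ω => soliton (C ω) (x - X ω)) P :=
  (measurable_soliton.comp_aemeasurable
    (hC.prodMk (aemeasurable_const.sub hX))).aestronglyMeasurable

lemma norm_soliton_le_abs (c x : ℝ) : ‖soliton c x‖ ≤ 3 / 2 * |c| := by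
  rw [Real.norm_of_nonneg (soliton_nonneg _ _)]
  refine (soliton_le _ _).trans ?_
  gcongr
  exact max_le (le_abs_self c) (abs_nonneg c)

lemma integrable_soliton_comp (hC : Integrable C P) (hX : AEMeasurable X P) (x : ℝ) :
    Integrable (fun ω => soliton (C ω) (x - X ω)) P :=
  (hC.abs.const_mul (3 / 2)).mono' (aestronglyMeasurable_soliton hC.aemeasurable hX x)
    (Eventually.of_forall fun _ => norm_soliton_le_abs _ _)

/-- The averaged profile is continuous and vanishes at infinity, so it attains its maximum. -/
lemma exists_isGreatest_integral_soliton (hC : Integrable C P) (hX : AEMeasurable X P) :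
    ∃ m, IsGreatest (range fun x : ℝ => ∫ ω, soliton (C ω) (x - X ω) ∂P) m := by
  set G : ℝ → ℝ := fun x => ∫ ω, soliton (C ω) (x - X ω) ∂P with hG
  have hcont : Continuous G :=
    continuous_of_dominated (fun x => aestronglyMeasurable_soliton hC.aemeasurable hX x)
      (fun x => Eventually.of_forall fun _ => norm_soliton_le_abs _ _) (hC.abs.const_mul (3 / 2))
      (Eventually.of_forall fun ω => (continuous_soliton _).comp (by fun_prop))
  have hlim : Tendsto G (cocompact ℝ) (𝓝 0) := by
    have : Tendsto G (cocompact ℝ) (𝓝 (∫ _, (0 : ℝ) ∂P)) := by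
      -- Dominated convergence needs a countably generated filter, which is visible in this form.
      rw [cocompact_eq_atBot_atTop]
      refine tendsto_integral_filter_of_dominated_convergence _
        (Eventually.of_forall fun x => aestronglyMeasurable_soliton hC.aemeasurable hX x)
        (Eventually.of_forall fun x => Eventually.of_forall fun _ => norm_soliton_le_abs _ _)
        (hC.abs.const_mul (3 / 2)) (Eventually.of_forall fun ω => ?_)
      rw [← cocompact_eq_atBot_atTop]
      exact (tendsto_soliton_cocompact _).comp
        (Homeomorph.subRight (X ω)).isClosedEmbedding.tendsto_cocompact
    simpa using this
  have hnn : ∀ x, 0 ≤ G x := fun x => integral_nonneg fun _ => soliton_nonneg _ _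
  suffices ∃ x, ∀ y, G y ≤ G x by
    obtain ⟨x, hx⟩ := this
    exact ⟨G x, ⟨x, rfl⟩, by rintro _ ⟨y, rfl⟩; exact hx y⟩
  by_cases h : ∃ x₀, 0 < G x₀
  · obtain ⟨x₀, hx₀⟩ := h
    exact hcont.exists_forall_ge' x₀ ((hlim.eventually (gt_mem_nhds hx₀)).mono fun _ h => h.le)
  · push Not at h
    exact ⟨0, fun y => (h y).trans (hnn 0)⟩

end Maximum

/-! ### Averaging over the speed and passage to the continuous drift. -/

section Decay

variable {Ω : Type*} [MeasurableSpace Ω] {P : Measure Ω}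
  {B : Fin 2 → ℝ≥0 → Ω → ℝ} {σ : Matrix (Fin 2) (Fin 2) ℝ} {X C : ℝ≥0 → Ω → ℝ}

lemma IsCorrelatedBrownian.integral_sq (hB : IsCorrelatedBrownian B σ P) (t : ℝ≥0) :
    ∫ ω, B 0 t ω ^ 2 ∂P = σ 0 0 * t := by
  have h := hB.cov_eq 0 0 t t
  rw [min_self, covariance_self (hB.hasGaussianLaw 0 t).aemeasurable,
    variance_of_integral_eq_zero (hB.hasGaussianLaw 0 t).aemeasurable (hB.mean_zero 0 t)] at h
  exact h

lemma SolvesModulation.ae_speed_eq {c₀ ε : ℝ} (hXC : SolvesModulation c₀ ε B X C P) (t : ℝ≥0) :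
    C t =ᵐ[P] fun ω => c₀ + ε * B 0 t ω := hXC.mono fun _ h => (h t).2

lemma ae_tendsto_discreteDrift (hB : IsCorrelatedBrownian B σ P) (t : ℝ≥0) :
    ∀ᵐ ω ∂P, Tendsto (fun n => discreteDrift B t n ω) atTop
      (𝓝 ((∫ s in (0 : ℝ)..t, B 0 s.toNNReal ω) + B 1 t ω)) := by
  filter_upwards [hB.continuous_paths 0] with ω hω
  have h := tendsto_riemann_sum (f := fun s => B 0 s.toNNReal ω)
    (hω.comp continuous_real_toNNReal) t.coe_nonneg
  refine (h.congr fun n => Finset.sum_congr rfl fun i _ => ?_).add_const _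
  have : ((t : ℝ) * (i + 1) / n).toNNReal = gridPoint t n i := by
    refine NNReal.coe_injective ?_
    rw [Real.coe_toNNReal _ (by positivity)]
    simp [gridPoint]
  rw [this]

lemma SolvesModulation.ae_tendsto {c₀ ε : ℝ} (hB : IsCorrelatedBrownian B σ P)
    (hXC : SolvesModulation c₀ ε B X C P) (t : ℝ≥0) :
    ∀ᵐ ω ∂P, Tendsto (fun n => c₀ * t + ε * discreteDrift B t n ω) atTop (𝓝 (X t ω)) := by
  filter_upwards [hXC, ae_tendsto_discreteDrift hB t] with ω h1 h2
  rw [(h1 t).1, add_assoc, ← mul_add]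
  exact (h2.const_mul ε).const_add _

/-- Young's inequality s ≤ s⁴/(4A³) + 3A/4 for s = √c⁺, with equality at s = A. It reduces the mean
of √C⁺ to the explicit second moment of C; A is chosen later as the typical size of √C⁺. -/
lemma sqrt_max_le (c : ℝ) {A : ℝ} (hA : 0 < A) :
    Real.sqrt (max c 0) ≤ c ^ 2 / (4 * A ^ 3) + 3 / 4 * A := by
  have h0 : 0 ≤ max c 0 := le_max_right _ _
  set s := Real.sqrt (max c 0) with hs
  have hs0 : 0 ≤ s := Real.sqrt_nonneg _
  have hss : s ^ 2 = max c 0 := Real.sq_sqrt h0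
  have hc : s ^ 4 ≤ c ^ 2 := by
    have : s ^ 4 = (max c 0) ^ 2 := by rw [← hss]; ring
    rw [this]
    rcases le_total 0 c with h | h
    · rw [max_eq_left h]
    · rw [max_eq_right h]; nlinarith
  have h1 : s ≤ s ^ 4 / (4 * A ^ 3) + 3 / 4 * A := by
    rw [← sub_nonneg]
    have : s ^ 4 / (4 * A ^ 3) + 3 / 4 * A - s
        = (s - A) ^ 2 * ((s + A) ^ 2 + 2 * A ^ 2) / (4 * A ^ 3) := by
      field_simp; ring
    rw [this]; positivity
  refine h1.trans ?_
  gcongr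


lemma SolvesModulation.aemeasurable_position {c₀ ε : ℝ} (hB : IsCorrelatedBrownian B σ P)
    (hXC : SolvesModulation c₀ ε B X C P) (t : ℝ≥0) : AEMeasurable (X t) P :=
  aemeasurable_of_tendsto_metrizable_ae atTop
    (fun n => ((hB.hasGaussianLaw_drift t n).snd.aemeasurable.const_mul ε).const_add (c₀ * t))
    (hXC.ae_tendsto hB t)

variable [IsProbabilityMeasure P]

lemma IsCorrelatedBrownian.lintegral_sqrt_le (hB : IsCorrelatedBrownian B σ P) (c₀ ε : ℝ)
    (t : ℝ≥0) {A : ℝ} (hA : 0 < A) :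
    ∫⁻ ω, ENNReal.ofReal (Real.sqrt (max (c₀ + ε * B 0 t ω) 0)) ∂P
      ≤ ENNReal.ofReal ((c₀ ^ 2 + ε ^ 2 * (σ 0 0 * t)) / (4 * A ^ 3) + 3 / 4 * A) := by
  have hi : Integrable (B 0 t) P := (hB.hasGaussianLaw 0 t).integrable
  have hi2 : Integrable (fun ω => B 0 t ω ^ 2) P := (hB.memLp 0 t).integrable_sq
  have h1 : Integrable (fun ω => c₀ ^ 2 + 2 * c₀ * ε * B 0 t ω) P :=
    (integrable_const _).add (hi.const_mul _)
  have h2 : Integrable (fun ω => ε ^ 2 * B 0 t ω ^ 2) P := hi2.const_mul _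
  have heq : ∀ ω, (c₀ + ε * B 0 t ω) ^ 2
      = (c₀ ^ 2 + 2 * c₀ * ε * B 0 t ω) + ε ^ 2 * B 0 t ω ^ 2 := fun ω => by ring
  have hsq : Integrable (fun ω => (c₀ + ε * B 0 t ω) ^ 2) P := by
    simp only [heq]; exact h1.add h2
  have hint : ∫ ω, (c₀ + ε * B 0 t ω) ^ 2 ∂P = c₀ ^ 2 + ε ^ 2 * (σ 0 0 * t) := by
    simp only [heq]
    rw [integral_add h1 h2, integral_add (integrable_const _) (hi.const_mul _),
      integral_const_mul, integral_const_mul, hB.mean_zero, hB.integral_sq]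
    simp
  calc ∫⁻ ω, ENNReal.ofReal (Real.sqrt (max (c₀ + ε * B 0 t ω) 0)) ∂P
      ≤ ∫⁻ ω, ENNReal.ofReal ((c₀ + ε * B 0 t ω) ^ 2 / (4 * A ^ 3) + 3 / 4 * A) ∂P :=
        lintegral_mono fun ω => ENNReal.ofReal_le_ofReal (sqrt_max_le _ hA)
    _ = ENNReal.ofReal (∫ ω, ((c₀ + ε * B 0 t ω) ^ 2 / (4 * A ^ 3) + 3 / 4 * A) ∂P) :=
        (ofReal_integral_eq_lintegral_ofReal (by exact (hsq.div_const _).add (integrable_const _))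
          (Eventually.of_forall fun ω => by positivity)).symm
    _ = _ := by
        rw [integral_add (hsq.div_const _) (integrable_const _), integral_div, hint]
        simp

/-- The estimate for the discretized position, before letting the mesh tend to zero. -/
lemma IsCorrelatedBrownian.lintegral_soliton_discrete_le (hB : IsCorrelatedBrownian B σ P)
    (hσ : 0 < σ 0 0) (c₀ : ℝ) {ε : ℝ} (hε : 0 < ε) {t : ℝ≥0} (ht : 0 < t)
    (ht' : -(σ 1 1 - σ 0 1 ^ 2 / σ 0 0) ≤ σ 0 0 * t ^ 2 / 32) {n : ℕ} (hn : 2 ≤ n) (x : ℝ)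
    {A : ℝ} (hA : 0 < A) :
    ∫⁻ ω, ENNReal.ofReal
        (soliton (c₀ + ε * B 0 t ω) (x - (c₀ * t + ε * discreteDrift B t n ω))) ∂P
      ≤ ENNReal.ofReal ((ε * Real.sqrt (2 * Real.pi * (σ 0 0 * t ^ 3 / 32)))⁻¹ *
        (3 * Real.pi * ((c₀ ^ 2 + ε ^ 2 * (σ 0 0 * t)) / (4 * A ^ 3) + 3 / 4 * A))) := by
  obtain ⟨β, hind, hgauss, hvar⟩ := hB.exists_indep_residual hσ ht ht' hn
  have ht0 : (0 : ℝ) < t := by exact_mod_cast ht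
  set Z := driftResidual B t n β with hZ
  have hgauss' : HasGaussianLaw (fun ω => ε * Z ω) P := hgauss.fun_smul ε
  have hind' : IndepFun (B 0 t) (fun ω => ε * Z ω) P :=
    hind.comp measurable_id (measurable_const_mul ε)
  have hv0 : 0 < σ 0 0 * (t : ℝ) ^ 3 / 32 := by positivity
  set v : ℝ≥0 := (variance (fun ω => ε * Z ω) P).toNNReal with hv
  have hvv : (v : ℝ) = ε ^ 2 * variance Z P := by
    rw [hv, Real.coe_toNNReal _ (variance_nonneg _ _), variance_const_mul]
  have hvpos : (0 : ℝ) < v := by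
    rw [hvv]; have := hv0.trans_le hvar; positivity
  have hvle : (Real.sqrt (2 * Real.pi * v))⁻¹
      ≤ (ε * Real.sqrt (2 * Real.pi * (σ 0 0 * t ^ 3 / 32)))⁻¹ := by
    have : ε * Real.sqrt (2 * Real.pi * (σ 0 0 * t ^ 3 / 32))
        = Real.sqrt (2 * Real.pi * (ε ^ 2 * (σ 0 0 * t ^ 3 / 32))) := by
      rw [show 2 * Real.pi * (ε ^ 2 * (σ 0 0 * (t : ℝ) ^ 3 / 32))
        = ε ^ 2 * (2 * Real.pi * (σ 0 0 * t ^ 3 / 32)) by ring,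
        Real.sqrt_mul (sq_nonneg ε), Real.sqrt_sq hε.le]
    rw [this, hvv]
    gcongr
  -- With B₁(t) = p.1 fixed, the position is a deterministic shift, including the regression term β
  -- p.1, plus the independent Gaussian ε Z = p.2.
  let F : ℝ × ℝ → ℝ≥0∞ := fun p =>
    ENNReal.ofReal (soliton (c₀ + ε * p.1) ((x - c₀ * t - ε * β * p.1) - p.2))
  have hpair : Measurable fun p : ℝ × ℝ =>
    (c₀ + ε * p.1, (x - c₀ * t - ε * β * p.1) - p.2) := by fun_prop
  have hF : Measurable F := ENNReal.measurable_ofReal.comp (measurable_soliton.comp hpair)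
  have hB0 := (hB.hasGaussianLaw 0 t).aemeasurable
  calc ∫⁻ ω, ENNReal.ofReal
        (soliton (c₀ + ε * B 0 t ω) (x - (c₀ * t + ε * discreteDrift B t n ω))) ∂P
      = ∫⁻ ω, F (B 0 t ω, ε * Z ω) ∂P := by
        refine lintegral_congr fun ω => ?_
        simp only [F, hZ, driftResidual]
        congr 2
        ring
    _ ≤ ENNReal.ofReal (Real.sqrt (2 * Real.pi * v))⁻¹ * ∫⁻ ω, (∫⁻ z, F (B 0 t ω, z)) ∂P :=
        lintegral_le_of_indepFun_gaussian hB0 hgauss'.aemeasurable hind'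
          hgauss'.map_eq_gaussianReal (by exact_mod_cast hvpos.ne') hF
    _ ≤ ENNReal.ofReal (ε * Real.sqrt (2 * Real.pi * (σ 0 0 * t ^ 3 / 32)))⁻¹ *
          ∫⁻ ω, ENNReal.ofReal (3 * Real.pi) *
            ENNReal.ofReal (Real.sqrt (max (c₀ + ε * B 0 t ω) 0)) ∂P := by
        refine mul_le_mul' (ENNReal.ofReal_le_ofReal hvle) (lintegral_mono fun ω => ?_)
        rw [← ENNReal.ofReal_mul (by positivity)]
        simp only [F]
        -- Lebesgue measure is invariant under z ↦ a - z, so the shift disappears and only the mass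
        -- of the profile remains.
        rw [lintegral_sub_left_eq_self (fun z => ENNReal.ofReal (soliton (c₀ + ε * B 0 t ω) z))]
        exact lintegral_soliton_le _
    _ ≤ _ := by
        rw [lintegral_const_mul' _ _ ENNReal.ofReal_ne_top,
          ENNReal.ofReal_mul (p := (ε * _)⁻¹) (by positivity),
          ENNReal.ofReal_mul (p := 3 * Real.pi) (by positivity)]
        gcongr
        exact hB.lintegral_sqrt_le c₀ ε t hA

lemma SolvesModulation.integrable_speed {c₀ ε : ℝ} (hB : IsCorrelatedBrownian B σ P)
    (hXC : SolvesModulation c₀ ε B X C P) (t : ℝ≥0) : Integrable (C t) P :=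
  ((integrable_const c₀).add ((hB.hasGaussianLaw 0 t).integrable.const_mul ε)).congr
    (hXC.ae_speed_eq t).symm

/-- Fatou's lemma along the mesh: the discretized positions converge almost surely to X(t), the
profile is continuous, and the discrete bound does not depend on n ≥ 2. -/
lemma SolvesModulation.integral_soliton_le {c₀ ε : ℝ} (hB : IsCorrelatedBrownian B σ P)
    (hXC : SolvesModulation c₀ ε B X C P) (hσ : 0 < σ 0 0) (hε : 0 < ε) {t : ℝ≥0} (ht : 0 < t)
    (ht' : -(σ 1 1 - σ 0 1 ^ 2 / σ 0 0) ≤ σ 0 0 * t ^ 2 / 32) (x : ℝ) {A : ℝ} (hA : 0 < A) :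
    ∫ ω, soliton (C t ω) (x - X t ω) ∂P
      ≤ (ε * Real.sqrt (2 * Real.pi * (σ 0 0 * t ^ 3 / 32)))⁻¹ *
        (3 * Real.pi * ((c₀ ^ 2 + ε ^ 2 * (σ 0 0 * t)) / (4 * A ^ 3) + 3 / 4 * A)) := by
  have hX := hXC.aemeasurable_position hB t
  have hC := hXC.integrable_speed hB t
  have ht0 : (0 : ℝ) < t := by exact_mod_cast ht
  have hmeas : ∀ n, AEMeasurable (fun ω => ENNReal.ofReal
      (soliton (c₀ + ε * B 0 t ω) (x - (c₀ * t + ε * discreteDrift B t n ω)))) P := fun n =>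
    (aestronglyMeasurable_soliton
      (((hB.hasGaussianLaw 0 t).aemeasurable.const_mul ε).const_add c₀)
      (((hB.hasGaussianLaw_drift t n).snd.aemeasurable.const_mul ε).const_add (c₀ * t))
      x).aemeasurable.ennreal_ofReal
  refine (ENNReal.ofReal_le_ofReal_iff (by positivity)).1 ?_
  rw [ofReal_integral_eq_lintegral_ofReal (integrable_soliton_comp hC hX x)
    (Eventually.of_forall fun _ => soliton_nonneg _ _)]
  calc ∫⁻ ω, ENNReal.ofReal (soliton (C t ω) (x - X t ω)) ∂P
      = ∫⁻ ω, liminf (fun n => ENNReal.ofReal (soliton (c₀ + ε * B 0 t ω)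
          (x - (c₀ * t + ε * discreteDrift B t n ω)))) atTop ∂P := by
        refine lintegral_congr_ae ?_
        filter_upwards [hXC.ae_tendsto hB t, hXC.ae_speed_eq t] with ω h1 h2
        rw [h2]
        exact (ENNReal.tendsto_ofReal (((continuous_soliton _).tendsto _).comp
          (h1.const_sub x))).liminf_eq.symm
    _ ≤ liminf (fun n => ∫⁻ ω, ENNReal.ofReal (soliton (c₀ + ε * B 0 t ω)
          (x - (c₀ * t + ε * discreteDrift B t n ω))) ∂P) atTop := lintegral_liminf_le' hmeas
    _ ≤ _ := by
        refine liminf_le_of_frequently_le' (Eventually.frequently ?_)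
        filter_upwards [eventually_ge_atTop 2] with n hn
        exact hB.lintegral_soliton_discrete_le hσ c₀ hε ht ht' hn x hA

end Decay

/-! ### The constant, the onset time and the rate. -/

/-- The constant in the decay rate of the averaged soliton. -/
noncomputable def decayConstant (c₀ : ℝ) (σ : Matrix (Fin 2) (Fin 2) ℝ) : ℝ :=
  3 * Real.pi * ((c₀ ^ 2 + σ 0 0) / 4 + 3 / 4) / Real.sqrt (2 * Real.pi * (σ 0 0 / 32))

lemma decayConstant_pos (c₀ : ℝ) {σ : Matrix (Fin 2) (Fin 2) ℝ} (hσ : 0 < σ 0 0) :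
    0 < decayConstant c₀ σ := by
  unfold decayConstant; positivity

/-- A time after which the diffusive regime has set in. -/
noncomputable def decayTime (σ : Matrix (Fin 2) (Fin 2) ℝ) (ε : ℝ) : ℝ :=
  1 + 1 / ε ^ 2 + 32 * |σ 1 1 - σ 0 1 ^ 2 / σ 0 0| / σ 0 0

lemma decayTime_pos {σ : Matrix (Fin 2) (Fin 2) ℝ} (hσ : 0 < σ 0 0) {ε : ℝ} (hε : 0 < ε) :
    0 < decayTime σ ε := by
  unfold decayTime; positivity

/-- The choice A = (ε²t)^(1/4) balances the two terms of Young's inequality, since C² has mean c₀² +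
aε²t ≤ (c₀² + a)A⁴ when ε²t ≥ 1. -/
lemma rate_le (c₀ : ℝ) {a ε t : ℝ} (ha : 0 < a) (hε : 0 < ε) (ht : 0 < t) (h : 1 ≤ ε ^ 2 * t) :
    (ε * Real.sqrt (2 * Real.pi * (a * t ^ 3 / 32)))⁻¹ *
        (3 * Real.pi * ((c₀ ^ 2 + ε ^ 2 * (a * t)) / (4 * (ε ^ (1 / 2 : ℝ) * t ^ (1 / 4 : ℝ)) ^ 3)
          + 3 / 4 * (ε ^ (1 / 2 : ℝ) * t ^ (1 / 4 : ℝ))))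
      ≤ 3 * Real.pi * ((c₀ ^ 2 + a) / 4 + 3 / 4) / Real.sqrt (2 * Real.pi * (a / 32))
        * ε ^ (-(1 / 2) : ℝ) * t ^ (-(5 / 4) : ℝ) := by
  set A : ℝ := ε ^ (1 / 2 : ℝ) * t ^ (1 / 4 : ℝ) with hAdef
  have hA : 0 < A := by positivity
  have hA4 : A ^ 4 = ε ^ 2 * t := by
    rw [hAdef, mul_pow, ← Real.rpow_natCast, ← Real.rpow_natCast, ← Real.rpow_mul hε.le,
      ← Real.rpow_mul ht.le]
    norm_num
  have hsplit : Real.sqrt (2 * Real.pi * (a * t ^ 3 / 32))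
      = Real.sqrt (2 * Real.pi * (a / 32)) * t ^ (3 / 2 : ℝ) := by
    rw [show 2 * Real.pi * (a * t ^ 3 / 32) = 2 * Real.pi * (a / 32) * t ^ 3 by ring,
      Real.sqrt_mul (by positivity), Real.sqrt_eq_rpow (t ^ 3), ← Real.rpow_natCast,
      ← Real.rpow_mul ht.le]
    norm_num
  have hpow : A / (ε * t ^ (3 / 2 : ℝ)) = ε ^ (-(1 / 2) : ℝ) * t ^ (-(5 / 4) : ℝ) := by
    rw [hAdef, mul_div_mul_comm, ← Real.rpow_sub ht]
    nth_rewrite 2 [← Real.rpow_one ε]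
    rw [← Real.rpow_sub hε]
    norm_num
  have hbr : (c₀ ^ 2 + ε ^ 2 * (a * t)) / (4 * A ^ 3) + 3 / 4 * A
      ≤ ((c₀ ^ 2 + a) / 4 + 3 / 4) * A := by
    have : (c₀ ^ 2 + ε ^ 2 * (a * t)) / (4 * A ^ 3) ≤ (c₀ ^ 2 + a) / 4 * A := by
      rw [div_le_iff₀ (by positivity)]
      have : (c₀ ^ 2 + a) / 4 * A * (4 * A ^ 3) = (c₀ ^ 2 + a) * (ε ^ 2 * t) := by
        rw [← hA4]; ring
      rw [this]
      nlinarith [sq_nonneg c₀]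
    linarith
  rw [mul_assoc _ (ε ^ _), ← hpow, hsplit]
  calc _ ≤ (ε * (Real.sqrt (2 * Real.pi * (a / 32)) * t ^ (3 / 2 : ℝ)))⁻¹ *
        (3 * Real.pi * (((c₀ ^ 2 + a) / 4 + 3 / 4) * A)) := by gcongr
    _ = _ := by
      have : 0 < Real.sqrt (2 * Real.pi * (a / 32)) := by positivity
      field_simp

theorem averaged_soliton_decay (c₀ : ℝ) (σ : Matrix (Fin 2) (Fin 2) ℝ) (hσ : 0 < σ 0 0) {ε : ℝ}
    (hε : 0 < ε) {Ω : Type*} [MeasurableSpace Ω] {P : Measure Ω} [IsProbabilityMeasure P]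
    {B : Fin 2 → ℝ≥0 → Ω → ℝ} {X C : ℝ≥0 → Ω → ℝ} (hB : IsCorrelatedBrownian B σ P)
    (hXC : SolvesModulation c₀ ε B X C P) {t : ℝ≥0} (ht : decayTime σ ε ≤ t) (x : ℝ) :
    ∫ ω, soliton (C t ω) (x - X t ω) ∂P
      ≤ decayConstant c₀ σ * ε ^ (-(1 / 2) : ℝ) * (t : ℝ) ^ (-(5 / 4) : ℝ) := by
  have h1 : 0 ≤ 32 * |σ 1 1 - σ 0 1 ^ 2 / σ 0 0| / σ 0 0 := by positivity
  have h2 : 0 < 1 / ε ^ 2 := by positivity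
  unfold decayTime at ht
  have ht1 : (1 : ℝ) ≤ t := by linarith
  have ht0 : (0 : ℝ) < t := by linarith
  have hεt : 1 ≤ ε ^ 2 * t := by
    have : 1 / ε ^ 2 ≤ t := by linarith
    rwa [div_le_iff₀ (by positivity), mul_comm] at this
  have hδ : -(σ 1 1 - σ 0 1 ^ 2 / σ 0 0) ≤ σ 0 0 * (t : ℝ) ^ 2 / 32 := by
    have h3 : 32 * |σ 1 1 - σ 0 1 ^ 2 / σ 0 0| / σ 0 0 ≤ t := by linarith
    rw [div_le_iff₀ hσ] at h3
    have h4 : (t : ℝ) * σ 0 0 ≤ σ 0 0 * t ^ 2 := by nlinarith [mul_pos hσ ht0]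
    linarith [neg_abs_le (σ 1 1 - σ 0 1 ^ 2 / σ 0 0)]
  exact (hXC.integral_soliton_le hB hσ hε (by exact_mod_cast ht0) hδ x
    (A := ε ^ (1 / 2 : ℝ) * (t : ℝ) ^ (1 / 4 : ℝ)) (by positivity)).trans
      (rate_le c₀ hσ hε ht0 hεt)

/-! ### Integrability from exponential bounds. -/

section ExponentialDecay

lemma integrable_exp_neg_mul_abs {a : ℝ} (ha : 0 < a) :
    Integrable fun x : ℝ => Real.exp (-(a * |x|)) := by
  rw [← integrableOn_univ, ← Iic_union_Ioi (a := (0 : ℝ))]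
  refine IntegrableOn.union ?_ ?_
  · refine (integrableOn_exp_mul_Iic ha 0).congr_fun (fun x hx => ?_) measurableSet_Iic
    simp only [abs_of_nonpos (mem_Iic.1 hx), mul_neg, neg_neg]
  · refine (integrableOn_exp_mul_Ioi (neg_lt_zero.2 ha) 0).congr_fun (fun x hx => ?_)
      measurableSet_Ioi
    simp only [abs_of_pos (mem_Ioi.1 hx), neg_mul]

lemma integrable_of_abs_le_exp {f : ℝ → ℝ} (hf : AEStronglyMeasurable f) {K a : ℝ} (ha : 0 < a)
    (h : ∀ x, |f x| ≤ K * Real.exp (-(a * |x|))) : Integrable f :=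
  ((integrable_exp_neg_mul_abs ha).const_mul K).mono' hf (Eventually.of_forall h)

end ExponentialDecay

/-! ### Injectivity of convolution by analyticity of the Fourier transform. -/

section Fourier

open Complex

lemma charFun_withDensity_ofReal {ψ : ℝ → ℝ} (hψ : AEMeasurable ψ) (t : ℝ) :
    charFun (volume.withDensity fun x => ENNReal.ofReal (ψ x)) t
      = ∫ x : ℝ, ((max (ψ x) 0 : ℝ) : ℂ) * cexp (t * x * I) := by
  rw [charFun_apply_real, integral_withDensity_eq_integral_toReal_smul₀ hψ.ennreal_ofReal
    (Eventually.of_forall fun _ => ENNReal.ofReal_lt_top)]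
  simp only [ENNReal.toReal_ofReal', real_smul]

lemma integrable_mul_cexp {g : ℝ → ℝ} (hg : Integrable g) (t : ℝ) :
    Integrable fun x : ℝ => (g x : ℂ) * cexp (t * x * I) := by
  have hgc : Integrable fun x => (g x : ℂ) := hg.ofReal
  refine hgc.mono (hgc.aestronglyMeasurable.mul (by fun_prop))
    (Eventually.of_forall fun x => ?_)
  rw [norm_mul, ← ofReal_mul, norm_exp_ofReal_mul_I, mul_one]

lemma continuous_integral_mul_cexp {g : ℝ → ℝ} (hg : Integrable g) :
    Continuous fun t : ℝ => ∫ x : ℝ, (g x : ℂ) * cexp (t * x * I) := by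
  refine continuous_of_dominated (bound := fun x => ‖(g x : ℂ)‖)
    (fun t => (integrable_mul_cexp hg t).aestronglyMeasurable)
    (fun t => Eventually.of_forall fun x => ?_) hg.ofReal.norm
    (Eventually.of_forall fun x => by fun_prop)
  rw [norm_mul, ← ofReal_mul, norm_exp_ofReal_mul_I, mul_one]

/-- An integrable function with vanishing Fourier transform is zero almost everywhere. -/
lemma ae_eq_zero_of_fourier_eq_zero {g : ℝ → ℝ} (hg : Integrable g)
    (h : ∀ t : ℝ, ∫ x : ℝ, (g x : ℂ) * cexp (t * x * I) = 0) : g =ᵐ[volume] 0 := by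
  have hfin : ∀ f : ℝ → ℝ, Integrable f →
      IsFiniteMeasure (volume.withDensity fun x => ENNReal.ofReal (f x)) := fun f hf =>
    isFiniteMeasure_withDensity_ofReal hf.2
  have hneg : AEMeasurable fun x => -g x := hg.aemeasurable.neg
  have := hfin g hg
  have := hfin (fun x => -g x) hg.neg
  -- The measures with densities g⁺ and g⁻ are finite, and their characteristic functions differ by
  -- the Fourier transform of g, which vanishes.
  have heq : volume.withDensity (fun x => ENNReal.ofReal (g x))
      = volume.withDensity fun x => ENNReal.ofReal (-g x) := by
    refine Measure.ext_of_charFun (funext fun t => ?_)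
    rw [charFun_withDensity_ofReal hg.aemeasurable, charFun_withDensity_ofReal hneg,
      ← sub_eq_zero, ← integral_sub (integrable_mul_cexp hg.pos_part t)
        (integrable_mul_cexp hg.neg_part t), ← h t]
    refine integral_congr_ae (Eventually.of_forall fun x => ?_)
    simp only
    rw [← sub_mul, ← ofReal_sub]
    congr 2
    rcases le_total 0 (g x) with hx | hx
    · rw [max_eq_left hx, max_eq_right (by linarith), sub_zero]
    · rw [max_eq_right hx, max_eq_left (by linarith)]; ring
  have hlt : ∫⁻ x, ENNReal.ofReal (g x) ≠ ∞ :=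
    ((lintegral_mono fun x => Real.ofReal_le_enorm (g x)).trans_lt hg.2).ne
  filter_upwards [(withDensity_eq_iff hg.aemeasurable.ennreal_ofReal
    hneg.ennreal_ofReal hlt).1 heq] with x hx
  rcases le_total 0 (g x) with h0 | h0
  · rw [ENNReal.ofReal_of_nonpos (neg_nonpos.2 h0), ENNReal.ofReal_eq_zero] at hx
    exact le_antisymm hx h0
  · rw [ENNReal.ofReal_of_nonpos h0, eq_comm, ENNReal.ofReal_eq_zero] at hx
    exact le_antisymm h0 (neg_nonpos.1 hx)

/-- The characteristic function of a nonzero measure with exponential moments has isolated zeros. -/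
lemma eventually_charFun_ne_zero {μ : Measure ℝ} [IsFiniteMeasure μ] (hμ : μ ≠ 0)
    (h0 : (0 : ℝ) ∈ interior (integrableExpSet id μ)) (t₀ : ℝ) :
    ∀ᶠ t in 𝓝[≠] t₀, charFun μ t ≠ 0 := by
  by_contra hcon
  rw [not_eventually] at hcon
  have hcon' : ∃ᶠ t : ℝ in 𝓝[≠] t₀, complexMGF id μ (t * I) = 0 :=
    hcon.mono fun t ht => by rw [complexMGF_id_mul_I]; exact not_not.1 ht
  have htend : Tendsto (fun t : ℝ => (t : ℂ) * I) (𝓝[≠] t₀) (𝓝[≠] ((t₀ : ℂ) * I)) := by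
    refine tendsto_nhdsWithin_iff.2 ⟨(Continuous.tendsto (by fun_prop) t₀).mono_left
      nhdsWithin_le_nhds, ?_⟩
    filter_upwards [self_mem_nhdsWithin] with t ht h
    exact ht (by simpa using h)
  -- Identity theorem on the strip of convergence: zeros accumulating on the imaginary axis force
  -- the complex moment generating function to vanish at 0 too, where its value is the total mass.
  have hpre : IsPreconnected {z : ℂ | z.re ∈ interior (integrableExpSet id μ)} :=
    (convex_integrableExpSet.interior.linear_preimage reLm).isPreconnected
  have := analyticOnNhd_complexMGF.eqOn_zero_of_preconnected_of_frequently_eq_zero hpre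
    (z₀ := (t₀ : ℂ) * I) (by simpa using h0) (htend.frequently hcon')
  have h00 := this (show (0 : ℂ) ∈ {z : ℂ | z.re ∈ interior (integrableExpSet id μ)} by
    simpa using h0)
  rw [Pi.zero_apply] at h00
  simp [complexMGF, measureReal_eq_zero_iff, hμ] at h00

/-- Convolution with a nonzero, nonnegative, exponentially decaying kernel is injective on `L¹`. -/
theorem ae_eq_zero_of_convolution_eq_zero {ψ g : ℝ → ℝ} (hψ : AEStronglyMeasurable ψ)
    (hψ0 : ∀ x, 0 ≤ ψ x) {K a : ℝ} (ha : 0 < a)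
    (hψa : ∀ x, ψ x ≤ K * Real.exp (-(a * |x|))) (hψi : 0 < ∫ x, ψ x) (hg : Integrable g)
    (hconv : ∀ᵐ x, ∫ s, ψ s * g (x - s) = 0) : g =ᵐ[volume] 0 := by
  have hψint : Integrable ψ :=
    integrable_of_abs_le_exp hψ ha fun x => by rw [abs_of_nonneg (hψ0 x)]; exact hψa x
  set μ : Measure ℝ := volume.withDensity fun x => ENNReal.ofReal (ψ x) with hμ
  have hfin : IsFiniteMeasure μ := isFiniteMeasure_withDensity_ofReal hψint.2
  have hcf : ∀ t : ℝ, charFun μ t = ∫ x : ℝ, (ψ x : ℂ) * cexp (t * x * I) := fun t => by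
    rw [hμ, charFun_withDensity_ofReal hψ.aemeasurable]
    simp only [max_eq_left (hψ0 _)]
  have hμ0 : μ ≠ 0 := fun h0 => by
    have h1 := hcf 0
    rw [h0] at h1
    simp at h1
    rw [integral_complex_ofReal] at h1
    exact hψi.ne (by exact_mod_cast h1)
  have hmom : (0 : ℝ) ∈ interior (integrableExpSet id μ) := by
    refine mem_interior.2 ⟨Ioo (-a) a, fun s hs => ?_, isOpen_Ioo, by simpa using ha⟩
    change Integrable (fun x => Real.exp (s * id x)) μ
    rw [hμ, integrable_withDensity_iff_integrable_smul₀' hψ.aemeasurable.ennreal_ofReal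
      (Eventually.of_forall fun _ => ENNReal.ofReal_lt_top)]
    have hsa : 0 < a - |s| := sub_pos.2 (abs_lt.2 hs)
    refine integrable_of_abs_le_exp (K := K) (a := a - |s|) ?_ hsa fun x => ?_
    · exact hψ.aemeasurable.ennreal_ofReal.ennreal_toReal.aestronglyMeasurable.smul
        (by fun_prop)
    · rw [ENNReal.toReal_ofReal (hψ0 x), smul_eq_mul, abs_of_nonneg
        (mul_nonneg (hψ0 x) (Real.exp_pos _).le)]
      calc ψ x * Real.exp (s * id x)
          ≤ K * Real.exp (-(a * |x|)) * Real.exp (|s| * |x|) := by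
            refine mul_le_mul (hψa x) (Real.exp_le_exp.2 ?_) (Real.exp_pos _).le
              ((hψ0 x).trans (hψa x))
            rw [← abs_mul]; exact le_abs_self _
        _ = _ := by rw [mul_assoc, ← Real.exp_add]; ring_nf
  -- The convolution of ψ e^(it·) with g e^(it·) is e^(itx) (ψ * g)(x), so integrating it yields the
  -- product of the transforms.
  have hprod : ∀ t : ℝ, charFun μ t * ∫ x : ℝ, (g x : ℂ) * cexp (t * x * I) = 0 := fun t => by
    have h1 := integral_convolution (μ := volume) (ν := volume) (ContinuousLinearMap.mul ℝ ℂ)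
      (integrable_mul_cexp hψint t) (integrable_mul_cexp hg t)
    rw [ContinuousLinearMap.mul_apply', ← hcf t] at h1
    rw [← h1]
    refine integral_eq_zero_of_ae ?_
    filter_upwards [hconv] with x hx
    simp only [convolution, ContinuousLinearMap.mul_apply', Pi.zero_apply]
    have : ∀ s : ℝ, (ψ s : ℂ) * cexp (t * s * I) * ((g (x - s) : ℂ) * cexp (t * ↑(x - s) * I))
        = cexp (t * x * I) * ((ψ s * g (x - s) : ℝ) : ℂ) := fun s => by
      rw [mul_mul_mul_comm, ← Complex.exp_add, ofReal_mul, mul_comm]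
      congr 2
      push_cast; ring
    simp only [this]
    rw [integral_const_mul, integral_complex_ofReal, hx]
    simp
  refine ae_eq_zero_of_fourier_eq_zero hg fun t₀ => ?_
  have hev : ∀ᶠ t : ℝ in 𝓝[≠] t₀, ∫ x : ℝ, (g x : ℂ) * cexp (t * x * I) = 0 :=
    (eventually_charFun_ne_zero hμ0 hmom t₀).mono fun t ht =>
      (mul_eq_zero.1 (hprod t)).resolve_left ht
  exact tendsto_nhds_unique (((continuous_integral_mul_cexp hg).tendsto t₀).mono_left
    nhdsWithin_le_nhds) (tendsto_const_nhds.congr' (hev.mono fun _ h => h.symm))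

end Fourier

/-! ### Regularity, decay and normalization of the test functions. -/

section ModulationFunctions

variable {c₀ : ℝ}

lemma hasDerivAt_soliton_speed (hc : 0 < c₀) (x : ℝ) :
    HasDerivAt (fun c => soliton c x) (soliton c₀ x / c₀ *
      (1 - Real.sqrt c₀ * x / 2 * Real.tanh (Real.sqrt c₀ * x / 2))) c₀ := by
  have hs : 0 < Real.sqrt c₀ := Real.sqrt_pos.2 hc
  have hss : Real.sqrt c₀ ^ 2 = c₀ := Real.sq_sqrt hc.le
  have hch := Real.cosh_pos (Real.sqrt c₀ * x / 2)
  have h1 := ((((Real.hasDerivAt_sqrt hc.ne').mul_const x).div_const 2).cosh.pow 2).const_mul 2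
  have h2 := ((hasDerivAt_id c₀).const_mul 3).div h1 (by simp only [Pi.pow_apply]; positivity)
  have hev : (fun c => soliton c x)
      =ᶠ[𝓝 c₀] fun c => 3 * c / (2 * Real.cosh (Real.sqrt c * x / 2) ^ 2) :=
    (lt_mem_nhds hc).mono fun c hc => soliton_of_pos hc x
  refine (HasDerivAt.congr_of_eventuallyEq h2 hev).congr_deriv ?_
  -- For u = √c x / 2 this is ∂_c u = u / (2c); the rest is then algebra in u alone.
  have hd : 1 / (2 * Real.sqrt c₀) * x / 2 = Real.sqrt c₀ * x / 2 / (2 * c₀) := by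
    nth_rewrite 3 [← hss]
    field_simp
  rw [soliton_of_pos hc, Real.tanh_eq_sinh_div_cosh, hd]
  simp only [id, Pi.pow_apply]
  generalize Real.sqrt c₀ * x / 2 = u at *
  field_simp
  push_cast
  ring

lemma dcSoliton_eq (hc : 0 < c₀) (x : ℝ) :
    dcSoliton c₀ x = soliton c₀ x / c₀ *
      (1 - Real.sqrt c₀ * x / 2 * Real.tanh (Real.sqrt c₀ * x / 2)) :=
  (hasDerivAt_soliton_speed hc x).deriv

lemma hasDerivAt_soliton_space (hc : 0 < c₀) (x : ℝ) :
    HasDerivAt (soliton c₀)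
      (-(Real.sqrt c₀ * Real.tanh (Real.sqrt c₀ * x / 2) * soliton c₀ x)) x := by
  have hch := Real.cosh_pos (Real.sqrt c₀ * x / 2)
  have h1 := ((((hasDerivAt_id x).const_mul (Real.sqrt c₀)).div_const 2).cosh.pow 2).const_mul 2
  have h2 := (hasDerivAt_const x (3 * c₀)).div h1 (by simp only [id, Pi.pow_apply]; positivity)
  have heq : soliton c₀ = fun x => 3 * c₀ / (2 * Real.cosh (Real.sqrt c₀ * x / 2) ^ 2) :=
    funext (soliton_of_pos hc)
  rw [heq]
  refine h2.congr_deriv ?_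
  rw [Real.tanh_eq_sinh_div_cosh]
  simp only [id, Pi.pow_apply]
  field_simp
  ring

lemma continuous_tanh : Continuous Real.tanh := by
  have : Real.tanh = fun x => Real.sinh x / Real.cosh x := funext Real.tanh_eq_sinh_div_cosh
  rw [this]
  exact Real.continuous_sinh.div Real.continuous_cosh fun x => (Real.cosh_pos x).ne'

lemma continuous_dcSoliton (hc : 0 < c₀) : Continuous (dcSoliton c₀) := by
  have h : dcSoliton c₀ = _ := funext (dcSoliton_eq hc)
  rw [h]
  have := continuous_soliton c₀
  have := continuous_tanh
  fun_prop

lemma soliton_le_exp (hc : 0 < c₀) (x : ℝ) :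
    soliton c₀ x ≤ 6 * c₀ * Real.exp (-(Real.sqrt c₀ * |x|)) := by
  rw [soliton_of_pos hc]
  have hs : 0 < Real.sqrt c₀ := Real.sqrt_pos.2 hc
  have h1 : Real.exp (Real.sqrt c₀ * |x| / 2) / 2 ≤ Real.cosh (Real.sqrt c₀ * x / 2) := by
    rw [← Real.cosh_abs, abs_div, abs_mul, abs_of_pos hs, abs_two, Real.cosh_eq]
    have := Real.exp_pos (-(Real.sqrt c₀ * |x| / 2))
    linarith
  have h2 : Real.exp (Real.sqrt c₀ * |x|) / 4 ≤ Real.cosh (Real.sqrt c₀ * x / 2) ^ 2 := by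
    have h3 : Real.exp (Real.sqrt c₀ * |x|) = Real.exp (Real.sqrt c₀ * |x| / 2) ^ 2 := by
      rw [← Real.exp_nat_mul]; congr 1; push_cast; ring
    calc _ = (Real.exp (Real.sqrt c₀ * |x| / 2) / 2) ^ 2 := by rw [h3]; ring
      _ ≤ _ := by gcongr
  rw [Real.exp_neg]
  calc 3 * c₀ / (2 * Real.cosh (Real.sqrt c₀ * x / 2) ^ 2)
      ≤ 3 * c₀ / (2 * (Real.exp (Real.sqrt c₀ * |x|) / 4)) := by gcongr
    _ = _ := by field_simp; ring

/-- Half of the exponential rate pays for a factor of linear growth, by 1 + y ≤ exp y. -/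
lemma abs_mul_soliton_le_exp (hc : 0 < c₀) {r M x : ℝ} (hM : 0 ≤ M)
    (h : |r| ≤ M * (1 + Real.sqrt c₀ * |x| / 2)) :
    |r * soliton c₀ x| ≤ M * (6 * c₀) * Real.exp (-(Real.sqrt c₀ / 2 * |x|)) := by
  rw [abs_mul, abs_of_nonneg (soliton_nonneg c₀ x)]
  have h1 : |r| ≤ M * Real.exp (Real.sqrt c₀ / 2 * |x|) := by
    refine h.trans (mul_le_mul_of_nonneg_left ?_ hM)
    have := Real.add_one_le_exp (Real.sqrt c₀ / 2 * |x|)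
    linarith
  calc |r| * soliton c₀ x
      ≤ M * Real.exp (Real.sqrt c₀ / 2 * |x|) * (6 * c₀ * Real.exp (-(Real.sqrt c₀ * |x|))) :=
        mul_le_mul h1 (soliton_le_exp hc x) (soliton_nonneg _ _) (by positivity)
    _ = M * (6 * c₀) * (Real.exp (Real.sqrt c₀ / 2 * |x|) *
          Real.exp (-(Real.sqrt c₀ * |x|))) := by ring
    _ = _ := by rw [← Real.exp_add]; ring_nf

lemma abs_tanh_le_one (u : ℝ) : |Real.tanh u| ≤ 1 := (Real.abs_tanh_lt_one u).le

lemma abs_one_sub_mul_tanh_le (u : ℝ) : |1 - u * Real.tanh u| ≤ 1 + |u| := by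
  refine (abs_sub _ _).trans ?_
  rw [abs_one, abs_mul]
  have := mul_le_mul_of_nonneg_left (abs_tanh_le_one u) (abs_nonneg u)
  linarith

lemma abs_dcSoliton_le_exp (hc : 0 < c₀) (x : ℝ) :
    |dcSoliton c₀ x| ≤ 1 / c₀ * (6 * c₀) * Real.exp (-(Real.sqrt c₀ / 2 * |x|)) := by
  have hs : 0 < Real.sqrt c₀ := Real.sqrt_pos.2 hc
  rw [dcSoliton_eq hc]
  have : soliton c₀ x / c₀ * (1 - Real.sqrt c₀ * x / 2 * Real.tanh (Real.sqrt c₀ * x / 2))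
      = 1 / c₀ * (1 - Real.sqrt c₀ * x / 2 * Real.tanh (Real.sqrt c₀ * x / 2)) * soliton c₀ x := by
    ring
  rw [this]
  refine abs_mul_soliton_le_exp hc (by positivity) ?_
  rw [abs_mul, abs_of_pos (by positivity : 0 < 1 / c₀)]
  refine mul_le_mul_of_nonneg_left ((abs_one_sub_mul_tanh_le _).trans_eq ?_) (by positivity)
  rw [abs_div, abs_mul, abs_of_pos hs, abs_two]

lemma integrable_dcSoliton (hc : 0 < c₀) : Integrable (dcSoliton c₀) :=
  integrable_of_abs_le_exp (continuous_dcSoliton hc).aestronglyMeasurable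
    (half_pos (Real.sqrt_pos.2 hc)) (abs_dcSoliton_le_exp hc)

lemma integrable_soliton (hc : 0 < c₀) : Integrable (soliton c₀) :=
  integrable_of_abs_le_exp (continuous_soliton c₀).aestronglyMeasurable (Real.sqrt_pos.2 hc)
    fun x => by rw [abs_of_nonneg (soliton_nonneg c₀ x)]; exact soliton_le_exp hc x

lemma abs_soliton_le (hc : 0 < c₀) (x : ℝ) : |soliton c₀ x| ≤ 3 / 2 * c₀ := by
  rw [abs_of_nonneg (soliton_nonneg c₀ x)]
  simpa [max_eq_left hc.le] using soliton_le c₀ x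

lemma integrable_soliton_mul (hc : 0 < c₀) {f : ℝ → ℝ} (hf : Integrable f) :
    Integrable fun x => soliton c₀ x * f x :=
  hf.bdd_mul (continuous_soliton c₀).aestronglyMeasurable
    (Eventually.of_forall fun x => abs_soliton_le hc x)

lemma integrable_soliton_sq (hc : 0 < c₀) : Integrable fun x => soliton c₀ x ^ 2 := by
  simpa only [sq] using integrable_soliton_mul hc (integrable_soliton hc)

lemma integral_soliton_sq_pos (hc : 0 < c₀) : 0 < ∫ x, soliton c₀ x ^ 2 := by
  rw [integral_pos_iff_support_of_nonneg (fun x => sq_nonneg _) (integrable_soliton_sq hc)]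
  have : Function.support (fun x => soliton c₀ x ^ 2) = univ := by
    refine eq_univ_of_forall fun x => ?_
    have hch := Real.cosh_pos (Real.sqrt c₀ * x / 2)
    rw [Function.mem_support, soliton_of_pos hc]
    positivity
  rw [this]
  simp

/-- `(φ_c, ∂_c φ_c) = 3 / (4 c) ‖φ_c‖²`, by scaling. -/
lemma integral_soliton_mul_dcSoliton (hc : 0 < c₀) :
    ∫ x, soliton c₀ x * dcSoliton c₀ x = 3 / (4 * c₀) * ∫ x, soliton c₀ x ^ 2 := by
  have hs : 0 < Real.sqrt c₀ := Real.sqrt_pos.2 hc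
  have hi := integrable_soliton_mul hc (integrable_dcSoliton hc)
  have hi2 := integrable_soliton_sq hc
  -- Scaling in infinitesimal form: the combination of the two integrands is an exact derivative,
  -- whose integral over ℝ is zero.
  have hderiv : ∀ x, HasDerivAt (fun x => x * soliton c₀ x ^ 2)
      (4 * c₀ * (soliton c₀ x * dcSoliton c₀ x) - 3 * soliton c₀ x ^ 2) x := fun x => by
    refine ((hasDerivAt_id x).mul ((hasDerivAt_soliton_space hc x).pow 2)).congr_deriv ?_
    rw [dcSoliton_eq hc]
    simp only [id, Pi.pow_apply]
    field_simp
    ring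
  have hF : Integrable fun x => x * soliton c₀ x ^ 2 := by
    have h1 : Integrable fun x => x * soliton c₀ x := by
      refine integrable_of_abs_le_exp (continuous_id.mul (continuous_soliton c₀)).aestronglyMeasurable
        (half_pos hs) fun x => abs_mul_soliton_le_exp hc (M := 2 / Real.sqrt c₀) (by positivity) ?_
      have : 2 / Real.sqrt c₀ * (1 + Real.sqrt c₀ * |x| / 2) = 2 / Real.sqrt c₀ + |x| := by
        field_simp
      rw [this]
      have : 0 < 2 / Real.sqrt c₀ := by positivity
      linarith
    refine (integrable_soliton_mul hc h1).congr (Eventually.of_forall fun x => ?_)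
    simp only
    ring
  have h0 := integral_eq_zero_of_hasDerivAt_of_integrable hderiv
    ((hi.const_mul _).sub (hi2.const_mul _)) hF
  rw [integral_sub (hi.const_mul _) (hi2.const_mul _), integral_const_mul, integral_const_mul] at h0
  field_simp
  linarith

lemma theta₁_pos (hc : 0 < c₀) : 0 < theta₁ c₀ := by
  rw [theta₁, integral_soliton_mul_dcSoliton hc]
  have := integral_soliton_sq_pos hc
  positivity

lemma abs_dcPrimitive_le (hc : 0 < c₀) (x : ℝ) : |dcPrimitive c₀ x| ≤ ∫ y, |dcSoliton c₀ y| :=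
  (norm_integral_le_integral_norm _).trans
    (setIntegral_le_integral (integrable_dcSoliton hc).norm
      (Eventually.of_forall fun _ => norm_nonneg _))

lemma continuous_dcPrimitive (hc : 0 < c₀) : Continuous (dcPrimitive c₀) := by
  have hi := integrable_dcSoliton hc
  have : dcPrimitive c₀ = fun x => dcPrimitive c₀ 0 + ∫ y in (0 : ℝ)..x, dcSoliton c₀ y := by
    funext x
    rw [← intervalIntegral.integral_Iic_sub_Iic hi.integrableOn hi.integrableOn]
    simp [dcPrimitive]
  rw [this]
  exact continuous_const.add (intervalIntegral.continuous_primitive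
    (fun _ _ => (continuous_dcSoliton hc).intervalIntegrable _ _) 0)

lemma continuous_dualVector (hc : 0 < c₀) : Continuous (dualVector c₀) :=
  (continuous_const.mul (continuous_dcPrimitive hc)).add
    (continuous_const.mul (continuous_soliton c₀))

lemma exists_abs_dualVector_le (hc : 0 < c₀) : ∃ M, ∀ x, |dualVector c₀ x| ≤ M :=
  ⟨|theta₁ c₀| * (∫ y, |dcSoliton c₀ y|) + |theta₂ c₀| * (3 / 2 * c₀), fun x => by
    refine (abs_add_le _ _).trans ?_
    rw [abs_mul, abs_mul, abs_neg]
    gcongr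
    · exact abs_dcPrimitive_le hc x
    · exact abs_soliton_le hc x⟩

/-- The product of the profile with a bounded continuous function is square integrable. -/
lemma memLp_two_soliton_mul (hc : 0 < c₀) {g : ℝ → ℝ} (hg : Continuous g) {M : ℝ}
    (hM : ∀ x, |g x| ≤ M) : MemLp (fun x => soliton c₀ x * g x) 2 volume := by
  have hcont : Continuous fun x => soliton c₀ x * g x := (continuous_soliton c₀).mul hg
  have hi : Integrable fun x => soliton c₀ x * g x := by
    refine ((integrable_soliton hc).bdd_mul hg.aestronglyMeasurable
      (Eventually.of_forall fun x => hM x)).congr (Eventually.of_forall fun x => mul_comm _ _)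
  rw [memLp_two_iff_integrable_sq hcont.aestronglyMeasurable]
  refine ((hi.bdd_mul hg.aestronglyMeasurable (Eventually.of_forall fun x => hM x)).bdd_mul
    (continuous_soliton c₀).aestronglyMeasurable
    (Eventually.of_forall fun x => abs_soliton_le hc x)).congr (Eventually.of_forall fun x => ?_)
  simp only
  ring

lemma memLp_modulationTest (hc : 0 < c₀) (i : Fin 2) : MemLp (modulationTest c₀ i) 2 volume := by
  fin_cases i
  · have := memLp_two_soliton_mul hc (continuous_const.mul (continuous_soliton c₀))
      (g := fun x => theta₁ c₀ * soliton c₀ x) (M := |theta₁ c₀| * (3 / 2 * c₀)) fun x => by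
        rw [abs_mul]
        exact mul_le_mul_of_nonneg_left (abs_soliton_le hc x) (abs_nonneg _)
    convert! this using 1
    funext x
    simp only [modulationTest, Fin.zero_eta, Matrix.cons_val_zero]
    ring
  · obtain ⟨M, hM⟩ := exists_abs_dualVector_le hc
    exact (memLp_two_soliton_mul hc (continuous_dualVector hc) hM).neg

end ModulationFunctions

/-! ### Positivity of σ₁₁. -/

section Nondegeneracy

variable {c₀ : ℝ} {k : ℝ → ℝ}

lemma convAdjoint_eq_convolution (k f : ℝ → ℝ) (y : ℝ) :
    convAdjoint k f y = ∫ s, f s * k (-(y - s)) := by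
  simp only [convAdjoint, neg_sub, mul_comm]

lemma integrable_convAdjoint {f : ℝ → ℝ} (hk : Integrable k) (hf : Integrable f) :
    Integrable (convAdjoint k f) := by
  refine (hf.integrable_convolution (ContinuousLinearMap.mul ℝ ℝ) hk.comp_neg).congr
    (Eventually.of_forall fun y => ?_)
  rw [convAdjoint_eq_convolution]
  rfl

lemma abs_convAdjoint_le {f : ℝ → ℝ} (hk : Integrable k) {M : ℝ} (hM : ∀ x, |f x| ≤ M) (y : ℝ) :
    |convAdjoint k f y| ≤ M * ∫ x, |k x| := by
  have hi : Integrable fun x => M * |k (x - y)| := (hk.comp_sub_right y).abs.const_mul M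
  calc |convAdjoint k f y| ≤ ∫ x, M * |k (x - y)| := by
        change ‖∫ x, k (x - y) * f x‖ ≤ _
        refine norm_integral_le_of_norm_le hi (Eventually.of_forall fun x => ?_)
        rw [norm_mul, mul_comm, Real.norm_eq_abs, Real.norm_eq_abs]
        exact mul_le_mul_of_nonneg_right (hM x) (abs_nonneg _)
    _ = _ := by rw [integral_const_mul, integral_sub_right_eq_self (fun x => |k x|)]

lemma integrable_convAdjoint_sq {f : ℝ → ℝ} (hk : Integrable k) (hf : Integrable f) {M : ℝ}
    (hM : ∀ x, |f x| ≤ M) : Integrable fun y => convAdjoint k f y * convAdjoint k f y :=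
  (integrable_convAdjoint hk hf).bdd_mul (integrable_convAdjoint hk hf).aestronglyMeasurable
    (Eventually.of_forall fun y => abs_convAdjoint_le hk hM y)

/-- A zero value would make φ*h₁ vanish almost everywhere; h₁ is an admissible kernel for
`ae_eq_zero_of_convolution_eq_zero`, so the reflection of k, and with it k, would be zero. -/
theorem modulationCov_pos (hc : 0 < c₀) (hk : Integrable k) (hk0 : ¬ k =ᵐ[volume] 0) :
    0 < modulationCov k c₀ 0 0 := by
  have hs : 0 < Real.sqrt c₀ := Real.sqrt_pos.2 hc
  set h : ℝ → ℝ := modulationTest c₀ 0 with hh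
  have heq : ∀ x, h x = theta₁ c₀ * soliton c₀ x ^ 2 := fun x => rfl
  have hint : Integrable h := (integrable_soliton_sq hc).const_mul _
  have hbd : ∀ x, |h x| ≤ theta₁ c₀ * (3 / 2 * c₀) ^ 2 := fun x => by
    rw [heq, abs_mul, abs_of_pos (theta₁_pos hc), abs_pow]
    exact mul_le_mul_of_nonneg_left (pow_le_pow_left₀ (abs_nonneg _) (abs_soliton_le hc x) 2)
      (theta₁_pos hc).le
  have hsq := integrable_convAdjoint_sq hk hint hbd
  change 0 < ∫ y, convAdjoint k h y * convAdjoint k h y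
  refine (integral_nonneg fun y => mul_self_nonneg _).lt_of_ne' fun hzero => hk0 ?_
  rw [integral_eq_zero_iff_of_nonneg (fun y => mul_self_nonneg _) hsq] at hzero
  have hg := ae_eq_zero_of_convolution_eq_zero (ψ := h) (g := fun s => k (-s))
    (K := theta₁ c₀ * (3 / 2 * c₀) * (6 * c₀)) (a := Real.sqrt c₀) hint.aestronglyMeasurable
    (fun x => by rw [heq]; have := theta₁_pos hc; positivity) hs (fun x => ?_)
    (by
      simp only [heq]
      rw [integral_const_mul]
      exact mul_pos (theta₁_pos hc) (integral_soliton_sq_pos hc))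
    hk.comp_neg (hzero.mono fun y hy => by
      rw [← convAdjoint_eq_convolution]
      exact mul_self_eq_zero.1 hy)
  · have := (Measure.measurePreserving_neg (volume : Measure ℝ)).quasiMeasurePreserving.ae hg
    filter_upwards [this] with x hx
    simpa using hx
  · rw [heq, mul_assoc, mul_assoc, sq]
    refine mul_le_mul_of_nonneg_left ?_ (theta₁_pos hc).le
    have h1 := (le_abs_self _).trans (abs_soliton_le hc x)
    exact mul_le_mul h1 (soliton_le_exp hc x) (soliton_nonneg _ _) (by positivity)

end Nondegeneracy

lemma IsWienerNoise.isCorrelatedBrownian {Ω : Type*} [MeasurableSpace Ω] {P : Measure Ω} {c₀ : ℝ}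
    (hc : 0 < c₀) {k : ℝ → ℝ} {W : (ℝ → ℝ) → ℝ≥0 → Ω → ℝ} (hW : IsWienerNoise k W P) :
    IsCorrelatedBrownian (modulationNoise c₀ W) (modulationCov k c₀) P where
  gaussian := hW.gaussian.comp_right fun p : Fin 2 × ℝ≥0 =>
    (⟨modulationTest c₀ p.1, memLp_modulationTest hc p.1⟩, p.2)
  mean_zero i t := hW.mean_zero _ (memLp_modulationTest hc i) t
  cov_eq i j s t := (hW.cov_eq _ _ (memLp_modulationTest hc i) (memLp_modulationTest hc j) s t).trans
    (mul_comm _ _)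
  continuous_paths i := hW.continuous_paths _ (memLp_modulationTest hc i)

end KdVSoliton

theorem mainTheorem3 (c₀ : ℝ) (hc₀ : 0 < c₀) :
    (∀ σ : Matrix (Fin 2) (Fin 2) ℝ, 0 < σ 0 0 →
      ∃ K₀ : ℝ, 0 < K₀ ∧ ∀ ε : ℝ, 0 < ε → ∃ T : ℝ, 0 < T ∧
        ∀ (Ω : Type*) [MeasurableSpace Ω] (P : Measure Ω) [IsProbabilityMeasure P]
          (B : Fin 2 → ℝ≥0 → Ω → ℝ) (X C : ℝ≥0 → Ω → ℝ),
          KdVSoliton.IsCorrelatedBrownian B σ P →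
          KdVSoliton.SolvesModulation c₀ ε B X C P →
          ∀ t : ℝ≥0, T ≤ (t : ℝ) →
            (∀ x : ℝ, Integrable (fun ω => KdVSoliton.soliton (C t ω) (x - X t ω)) P) ∧
            ∃ m : ℝ,
              IsGreatest
                (range fun x : ℝ => ∫ ω, KdVSoliton.soliton (C t ω) (x - X t ω) ∂P) m ∧
              m ≤ K₀ * ε ^ (-(1 / 2) : ℝ) * (t : ℝ) ^ (-(5 / 4) : ℝ)) ∧
    (∀ k : ℝ → ℝ, Integrable k volume → MemLp k 2 volume → ¬ k =ᵐ[volume] 0 →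
      0 < KdVSoliton.modulationCov k c₀ 0 0 ∧
      ∀ (Ω : Type*) [MeasurableSpace Ω] (P : Measure Ω) [IsProbabilityMeasure P]
        (W : (ℝ → ℝ) → ℝ≥0 → Ω → ℝ),
        KdVSoliton.IsWienerNoise k W P →
        KdVSoliton.IsCorrelatedBrownian (KdVSoliton.modulationNoise c₀ W)
          (KdVSoliton.modulationCov k c₀) P) := by
  refine ⟨fun σ hσ => ⟨KdVSoliton.decayConstant c₀ σ, KdVSoliton.decayConstant_pos c₀ hσ,
    fun ε hε => ⟨KdVSoliton.decayTime σ ε, KdVSoliton.decayTime_pos hσ hε, ?_⟩⟩,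
    fun k hk _ hk0 => ⟨KdVSoliton.modulationCov_pos hc₀ hk hk0,
      fun Ω _ P _ W hW => hW.isCorrelatedBrownian hc₀⟩⟩
  intro Ω _ P _ B X C hB hXC t ht
  have hX := hXC.aemeasurable_position hB t
  have hC := hXC.integrable_speed hB t
  refine ⟨KdVSoliton.integrable_soliton_comp hC hX, ?_⟩
  obtain ⟨m, hm⟩ := KdVSoliton.exists_isGreatest_integral_soliton hC hX
  refine ⟨m, hm, ?_⟩
  -- The maximum is a value of the averaged profile, so the bound uniform in x applies to it.
  obtain ⟨x, rfl⟩ := hm.1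
  exact KdVSoliton.averaged_soliton_decay c₀ σ hσ hε hB hXC ht x
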